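/- For $n\ge 2$ write points of $\mathbb R^n$ as $x=(x',y)$ with $x'\in\mathbb R^{n-1}$, $y\in\mathbb R$. For $0<\gamma<1$ let $\phi(s)=s^\gamma$ if $s>0$ and $\phi(s)=0$ otherwise, and set $$\Omega_+=\{x\in(-1,1)^n: y>\phi(|x'|)\},\qquad \Omega_-=\{x\in(-1,1)^n: y<\phi(|x'|)\}.$$ For $\Omega\subset\mathbb R^n$ and $\eta>0$ let $\Omega^\eta=\{x\in\mathbb R^n:\operatorname{dist}(x,\Omega)<\eta\}$. For open $\Omega$ and $1\le p\le\infty$ let $L^p_{\mathrm{div}}(\Omega)=\{u\in L^p(\Omega;\mathbb R^n):\operatorname{div}u=0\text{ in }\mathcal D'(\Omega)\}$, with the $L^p$ norm. A bounded linear operator $\mathscr E:L^p_{\mathrm{div}}(\Omega)\to L^p_{\mathrm{div}}(\Omega')$, $\Omega\subset\Omega'$, is an extension operator if $\mathscr Eu=u$ a.e. in $\Omega$ for every $u$. For $\varepsilon>0$ and $0<\delta\le\infty$, an open set $\Omega$ is an $(\varepsilon,\delta)$-domain if any two distinct points $x,y\in\Omega$ with $|x-y|<\delta$ can be joined by a rectifiable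 curve $c$ in $\Omega$ of length less than $|x-y|/\varepsilon$ such that $\operatorname{dist}(z,\partial\Omega)\,|x-y|>\varepsilon\,|x-z|\,|y-z|$ for all $z$ on $c$. Then the following hold. (a) Let $n=2$. For every $0<\gamma<1$ there is $p\in[1,\infty)$ such that for every $\eta>0$ there is no bounded linear extension operator $L^p_{\mathrm{div}}(\Omega_+)\to L^p_{\mathrm{div}}(\Omega_+^\eta)$. (b) Let $n\ge2$. For every $0<\gamma<1$ there is $p\in(1,\infty)$ such that for every $\eta>0$ there is no bounded linear extension operator $L^p_{\mathrm{div}}(\Omega_-)\to L^p_{\mathrm{div}}(\Omega_-^\eta)$. (c) Let $n\ge3$. There are a bounded $(\varepsilon,\delta)$-domain $\Omega\subset\mathbb R^n$ (for some $\varepsilon>0$, $\delta\in(0,\infty]$), homeomorphic to the open unit ball, and $p\in(1,\infty)$ such that for every $\eta>0$ there is no bounded linear extension operator $L^p_{\mathrm{div}}(\Omega)\to L^p_{\mathrm{div}}(\Omega^\eta)$. -/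

import Mathlib

open MeasureTheory Set
open scoped ENNReal ContDiff

noncomputable section

/-- Euclidean space `ℝⁿ`, with the Euclidean norm. -/
abbrev Euc (n : ℕ) : Type := EuclideanSpace ℝ (Fin n)

/-! ### Solenoidal fields -/

/-- `div u = 0` in `𝒟'(Ω)`: `∫_Ω u · ∇φ = 0` for all `φ ∈ C_c^∞(Ω)`
(note that `fderiv ℝ φ x v = ∇φ(x) · v`). It is used only for `u ∈ L^p(Ω; ℝⁿ)` with `1 ≤ p`, for
which all these integrals converge, see `integrable_fderiv_apply`. -/
def DivFree {n : ℕ} (Ω : Set (Euc n)) (u : Euc n → Euc n) : Prop :=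
  ∀ φ : Euc n → ℝ, ContDiff ℝ ∞ φ → HasCompactSupport φ → tsupport φ ⊆ Ω →
    ∫ x in Ω, fderiv ℝ φ x (u x) = 0

theorem integrable_fderiv_apply {n : ℕ} {Ω : Set (Euc n)} {p : ℝ≥0∞} (hp : 1 ≤ p)
    {u : Euc n → Euc n} (hu : MemLp u p (volume.restrict Ω)) {φ : Euc n → ℝ}
    (hφ : ContDiff ℝ ∞ φ) (hc : HasCompactSupport φ) :
    Integrable (fun x => fderiv ℝ φ x (u x)) (volume.restrict Ω) := by
  have hcont : Continuous (fderiv ℝ φ) := hφ.continuous_fderiv (by simp)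
  have hcs : HasCompactSupport (fderiv ℝ φ) := hc.fderiv (𝕜 := ℝ)
  obtain ⟨C, hC⟩ := hcs.exists_bound_of_continuous hcont
  set K := tsupport (fderiv ℝ φ) with hK
  have hKc : IsCompact K := hcs
  have hu1 : IntegrableOn u K (volume.restrict Ω) :=
    (hu.locallyIntegrable hp).integrableOn_isCompact hKc
  have hmeas : AEStronglyMeasurable (fun x => fderiv ℝ φ x (u x)) (volume.restrict Ω) := by
    have h := isBoundedBilinearMap_apply (𝕜 := ℝ) (E := Euc n) (F := ℝ)
    exact h.continuous.comp_aestronglyMeasurable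
      (hcont.aestronglyMeasurable.prodMk hu.aestronglyMeasurable)
  have hon : IntegrableOn (fun x => fderiv ℝ φ x (u x)) K (volume.restrict Ω) := by
    refine Integrable.mono' (hu1.norm.const_mul C) hmeas.restrict ?_
    filter_upwards with x
    exact ((fderiv ℝ φ x).le_opNorm _).trans (by gcongr; exact hC x)
  refine (integrableOn_iff_integrable_of_support_subset ?_).1 hon
  intro x hx
  refine subset_tsupport _ ?_
  intro h0
  exact hx (by simp [h0])

/-- The space `L^p_div(Ω) = {u ∈ L^p(Ω; ℝⁿ) : div u = 0 in 𝒟'(Ω)}`, normed as a subspace of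
`L^p(Ω; ℝⁿ)`. -/
def LpDiv {n : ℕ} (p : ℝ≥0∞) [hp : Fact (1 ≤ p)] (Ω : Set (Euc n)) :
    Submodule ℝ (Lp (Euc n) p ((volume : Measure (Euc n)).restrict Ω)) where
  carrier := {u | DivFree Ω u}
  zero_mem' := by
    intro φ _ _ _
    rw [integral_eq_zero_of_ae]
    filter_upwards [Lp.coeFn_zero (Euc n) p ((volume : Measure (Euc n)).restrict Ω)] with x hx
    rw [hx]
    simp
  add_mem' := by
    intro u v hu hv φ h1 h2 h3
    have hu' := integrable_fderiv_apply hp.out (Lp.memLp u) h1 h2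
    have hv' := integrable_fderiv_apply hp.out (Lp.memLp v) h1 h2
    have h := integral_add hu' hv'
    rw [hu φ h1 h2 h3, hv φ h1 h2 h3, add_zero] at h
    rw [← h]
    refine integral_congr_ae ?_
    filter_upwards [Lp.coeFn_add u v] with x hx
    rw [hx]
    simp
  smul_mem' := by
    intro c u hu φ h1 h2 h3
    have h := integral_const_mul (μ := (volume : Measure (Euc n)).restrict Ω) c
      (fun x => fderiv ℝ φ x (u x))
    rw [hu φ h1 h2 h3, mul_zero] at h
    rw [← h]
    refine integral_congr_ae ?_
    filter_upwards [Lp.coeFn_smul c u] with x hx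
    rw [hx]
    simp

/-- There is a bounded linear operator `E : L^p_div(Ω) → L^p_div(Ω')` with `E u = u` a.e. in `Ω`
for all `u` (meant for `Ω ⊆ Ω'`). -/
def HasSolenoidalExtension {n : ℕ} (p : ℝ≥0∞) [Fact (1 ≤ p)] (Ω Ω' : Set (Euc n)) : Prop :=
  ∃ E : LpDiv p Ω →L[ℝ] LpDiv p Ω', ∀ u : LpDiv p Ω,
    ((E u : Lp (Euc n) p (volume.restrict Ω')) : Euc n → Euc n)
      =ᵐ[volume.restrict Ω] ((u : Lp (Euc n) p (volume.restrict Ω)) : Euc n → Euc n)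

/-! ### The cuspidal domains -/

/-- The profile `s ↦ s^γ` for `s > 0`, and `0` otherwise. -/
def cuspProfile (γ s : ℝ) : ℝ := if 0 < s then s ^ γ else 0

/-- The first `m` coordinates `x'` of `x = (x', y) ∈ ℝ^m × ℝ = ℝ^{m+1}`. -/
def horizontal {m : ℕ} (x : Euc (m + 1)) : Euc m := WithLp.toLp 2 fun i => x i.castSucc

/-- `Ω₊ = {(x', y) ∈ (-1,1)^n : y > φ(|x'|)}`, `n = m + 1`, with an outward cusp at `0`. -/
def outwardCusp (m : ℕ) (γ : ℝ) : Set (Euc (m + 1)) :=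
  {x | (∀ i, x i ∈ Ioo (-1 : ℝ) 1) ∧ x (Fin.last m) > cuspProfile γ ‖horizontal x‖}

/-- `Ω₋ = {(x', y) ∈ (-1,1)^n : y < φ(|x'|)}`, `n = m + 1`, with an inward cusp at `0`. -/
def inwardCusp (m : ℕ) (γ : ℝ) : Set (Euc (m + 1)) :=
  {x | (∀ i, x i ∈ Ioo (-1 : ℝ) 1) ∧ x (Fin.last m) < cuspProfile γ ‖horizontal x‖}

/-! ### `(ε, δ)`-domains -/

/-- `(ε, δ)`-domains, `ε > 0`, `0 < δ ≤ ∞`: any two distinct points `x, y ∈ Ω` with `|x - y| < δ`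
are joined by a curve `c` in `Ω` of length `< |x - y| / ε` (the length is the total variation, so
`c` is rectifiable) with `dist(z, ∂Ω) |x - y| > ε |x - z| |y - z|` for all `z` on `c`.
Distances to `∂Ω` are extended, so that the distance to the empty set is `∞`. -/
def IsEpsDeltaDomain {n : ℕ} (ε : ℝ) (δ : ℝ≥0∞) (Ω : Set (Euc n)) : Prop :=
  0 < ε ∧ 0 < δ ∧ IsOpen Ω ∧
    ∀ x ∈ Ω, ∀ y ∈ Ω, x ≠ y → edist x y < δ →
      ∃ c : Path x y, (∀ t, c t ∈ Ω) ∧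
        eVariationOn c univ < ENNReal.ofReal (dist x y / ε) ∧
        ∀ t, ENNReal.ofReal (ε * (dist x (c t) * dist y (c t))) <
          Metric.infEDist (c t) (frontier Ω) * edist x y

end

/-! In each case one explicit solenoidal field in `L^p` near the tip has no solenoidal `L^p`
extension to any neighbourhood of the domain. Test functions at scale `s` around the tip detect a
flux `c ≠ 0` independent of `s`. Hölder's inequality bounds what an extension could carry to balance
that flux by a positive power of `s`, and `s → 0` gives a contradiction.

Inward cusp, n = m + 1: the field is the point source `x / |x|ⁿ` at the tip. If `v` extends it, the
difference `w` of `v` and the source vanishes in the domain and has a nonzero point charge as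
divergence, so all the flux must return through the thin spike. The part of the spike in a ball of
radius `s` has volume at most a constant times `s^(m/γ + 1)`, which gives the factor `s^((m/γ + 1)(1
- 1/p) - 1)`. The source lies in `L^p` when `m(p - 1) < 1`, and the exponent is positive when `m(p -
1) > γ`; since `γ < 1` some `p` satisfies both (`not_hasSolenoidalExtension_of_thin_compl`,
`volume_real_ball_sdiff_inwardCusp_le`).

Outward cusp in the plane: the field is the shear flow `(1/y, 0)`, which is in `L^p` on the cusp
when `p < 1 + 1/γ` (`memLp_shearFlow`). Between heights comparable to `s` it carries across the cusp
a flux that does not depend on `s`. An extension has to absorb this flux in a ball of radius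
comparable to `s`, where Hölder allows only a multiple of `s^(1 - 2/p)`. Thus any `p` with `2 < p <
1 + 1/γ` works.

For (c) the inward cusp with `γ = 1/2` serves again. In dimension at least three one can walk around
the spike `|x'| ≤ y²`, so its complement in the cube is an `(ε, δ)`-domain
(`exists_lipschitz_curve_avoiding_spike`, `isEpsDeltaDomain_of_lipschitz_curves`). It is
homeomorphic to a ball because it is a subgraph over a cube. -/

open scoped RealInnerProductSpace

/-! ### Solenoidal fields: classical criterion, restriction, extension of a single field -/

/-- A field that is `C¹` on an open set with vanishing classical divergence is solenoidal there. -/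
theorem divFree_of_contDiffOn {n : ℕ} {U : Set (Euc n)} (hU : IsOpen U) {u : Euc n → Euc n}
    (hu : ContDiffOn ℝ 1 u U)
    (hdiv : ∀ x ∈ U, ∑ i, fderiv ℝ (fun y => u y i) x (EuclideanSpace.single i 1) = 0) :
    DivFree U u := by
  intro φ hφ hc hs
  have hui : ∀ i, ContDiffOn ℝ 1 (fun y => u y i) U := fun i =>
    (EuclideanSpace.proj (𝕜 := ℝ) i).contDiff.comp_contDiffOn hu
  have hφ' : Continuous (fderiv ℝ φ) := hφ.continuous_fderiv (by simp)
  have hexp : ∀ x, fderiv ℝ φ x (u x)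
      = ∑ i, u x i * fderiv ℝ φ x (EuclideanSpace.single i 1) := by
    intro x
    conv_lhs => rw [← (EuclideanSpace.basisFun (Fin n) ℝ).sum_repr (u x)]
    simp [map_sum]
  have hdz : ∀ x, x ∉ tsupport φ → fderiv ℝ φ x = 0 := fun x hx =>
    image_eq_zero_of_notMem_tsupport fun h => hx (tsupport_fderiv_subset ℝ h)
  -- Nothing is known about `u` off `U`, but every integrand below vanishes off `tsupport φ`, a
  -- compact subset of `U`. Such functions are continuous on the whole space, so integration by
  -- parts can be done there, one coordinate at a time.
  have hcs : ∀ f : Euc n → ℝ, ContinuousOn f U → (∀ x, x ∉ tsupport φ → f x = 0) →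
      Integrable f := by
    intro f hf h0
    have hsup : tsupport f ⊆ tsupport φ :=
      closure_minimal (fun x hx => by_contra fun h => hx (h0 x h)) (isClosed_tsupport _)
    refine Continuous.integrable_of_hasCompactSupport ?_ (hc.mono' ?_)
    · refine continuous_of_tsupport fun x hx => ?_
      exact hf.continuousAt (hU.mem_nhds (hs (hsup hx)))
    · exact (subset_tsupport f).trans hsup
  have hint1 : ∀ i, Integrable (fun x => u x i * fderiv ℝ φ x (EuclideanSpace.single i 1)) := by
    intro i
    refine hcs _ ((hui i).continuousOn.mul (by fun_prop)) fun x hx => by simp [hdz x hx]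
  have hfc : ∀ i, ContinuousOn
      (fun x => fderiv ℝ (fun y => u y i) x (EuclideanSpace.single i 1)) U := fun i =>
    ((hui i).continuousOn_fderiv_of_isOpen hU le_rfl).clm_apply continuousOn_const
  have hint2 : ∀ i, Integrable
      (fun x => fderiv ℝ (fun y => u y i) x (EuclideanSpace.single i 1) * φ x) := by
    intro i
    refine hcs _ ((hfc i).mul hφ.continuous.continuousOn) fun x hx => ?_
    simp [image_eq_zero_of_notMem_tsupport hx]
  have hint3 : ∀ i, Integrable (fun x => u x i * φ x) := by
    intro i
    refine hcs _ ((hui i).continuousOn.mul hφ.continuous.continuousOn) fun x hx => ?_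
    simp [image_eq_zero_of_notMem_tsupport hx]
  rw [setIntegral_eq_integral_of_forall_compl_eq_zero fun x hx => by
    rw [hdz x fun h => hx (hs h)]; simp]
  simp_rw [hexp]
  rw [integral_finsetSum _ fun i _ => hint1 i]
  have hibp : ∀ i, ∫ x, u x i * fderiv ℝ φ x (EuclideanSpace.single i 1)
      = -∫ x, fderiv ℝ (fun y => u y i) x (EuclideanSpace.single i 1) * φ x := fun i =>
    integral_mul_fderiv_eq_neg_fderiv_mul_of_integrable (hint2 i) (hint1 i) (hint3 i)
      (fun x hx => ((hui i).contDiffAt (hU.mem_nhds (hs hx))).differentiableAt (by simp))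
      (fun x _ => hφ.differentiable (by simp) x)
  simp_rw [hibp]
  rw [Finset.sum_neg_distrib, ← integral_finsetSum _ fun i _ => hint2 i, neg_eq_zero]
  refine integral_eq_zero_of_ae (.of_forall fun x => ?_)
  by_cases hx : x ∈ tsupport φ
  · simp [← Finset.sum_mul, hdiv x (hs hx)]
  · simp [image_eq_zero_of_notMem_tsupport hx]

theorem DivFree.mono {n : ℕ} {U V : Set (Euc n)} (h : U ⊆ V) {u : Euc n → Euc n}
    (hu : DivFree V u) : DivFree U u := by
  intro φ hφ hc hs
  have hz : ∀ x, x ∉ U → fderiv ℝ φ x (u x) = 0 := fun x hx => by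
    rw [image_eq_zero_of_notMem_tsupport (f := fderiv ℝ φ) fun h => hx (hs (tsupport_fderiv_subset ℝ h))]
    simp
  rw [setIntegral_eq_integral_of_forall_compl_eq_zero hz]
  have := hu φ hφ hc (hs.trans h)
  rwa [setIntegral_eq_integral_of_forall_compl_eq_zero fun x hx => hz x fun hx' => hx (h hx')]
    at this

theorem DivFree.congr_ae {n : ℕ} {U : Set (Euc n)} {u v : Euc n → Euc n}
    (hu : DivFree U u) (h : v =ᵐ[volume.restrict U] u) : DivFree U v := by
  intro φ hφ hc hs
  rw [← hu φ hφ hc hs]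
  refine integral_congr_ae ?_
  filter_upwards [h] with x hx
  rw [hx]

/-- An extension operator extends every solenoidal field in `L^p`. -/
theorem HasSolenoidalExtension.exists_extension {n : ℕ} {p : ℝ≥0∞} [Fact (1 ≤ p)]
    {Ω Ω' : Set (Euc n)} (h : HasSolenoidalExtension p Ω Ω') {u : Euc n → Euc n}
    (hu : MemLp u p (volume.restrict Ω)) (hd : DivFree Ω u) :
    ∃ v : Euc n → Euc n, MemLp v p (volume.restrict Ω') ∧ DivFree Ω' v ∧
      v =ᵐ[volume.restrict Ω] u := by
  obtain ⟨E, hE⟩ := h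
  let u' : LpDiv p Ω := ⟨hu.toLp u, hd.congr_ae hu.coeFn_toLp⟩
  exact ⟨_, Lp.memLp (E u' : Lp (Euc n) p (volume.restrict Ω')), (E u').2,
    (hE u').trans hu.coeFn_toLp⟩

/-! ### Hölder estimates on small sets -/

/-- Hölder's inequality against the constant `1` on a set of finite measure. -/
theorem setIntegral_norm_le_eLpNorm_mul {α F : Type*} [MeasurableSpace α] [NormedAddCommGroup F]
    {μ : Measure α} {p : ℝ≥0∞} (hp : 1 ≤ p) {f : α → F} (hf : MemLp f p μ) {s : Set α}
    (hs : μ s ≠ ⊤) :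
    ∫ x in s, ‖f x‖ ∂μ ≤ (eLpNorm f p μ).toReal * μ.real s ^ (1 - 1 / p.toReal) := by
  have h1 := eLpNorm_le_eLpNorm_mul_rpow_measure_univ (μ := μ.restrict s) hp
    hf.aestronglyMeasurable.restrict
  have h2 : eLpNorm f p (μ.restrict s) ≤ eLpNorm f p μ :=
    eLpNorm_mono_measure f Measure.restrict_le_self
  have hexp : (0 : ℝ) ≤ 1 - 1 / p.toReal := by
    rcases eq_or_ne p ⊤ with rfl | hpt
    · simp
    · have : (1 : ℝ) ≤ p.toReal := by
        simpa using (ENNReal.toReal_le_toReal (by simp) hpt).2 hp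
      rw [sub_nonneg, div_le_one (by linarith)]; exact this
  rw [integral_norm_eq_lintegral_enorm hf.aestronglyMeasurable.restrict,
    ← eLpNorm_one_eq_lintegral_enorm]
  rw [Measure.real, ENNReal.toReal_rpow, ← ENNReal.toReal_mul]
  refine ENNReal.toReal_mono ?_ (h1.trans ?_)
  · exact ENNReal.mul_ne_top hf.eLpNorm_ne_top (ENNReal.rpow_ne_top_of_nonneg hexp hs)
  · simp only [Measure.restrict_apply_univ, ENNReal.toReal_one, div_one]
    gcongr

/-- An integral over a set `E` of finite measure against an `Lᵖ` function `w`. -/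
theorem norm_integral_le_mul_eLpNorm_mul_measure_rpow {α F G : Type*} [MeasurableSpace α]
    [NormedAddCommGroup F] [NormedAddCommGroup G] [NormedSpace ℝ G] {μ : Measure α} {p : ℝ≥0∞}
    (hp : 1 ≤ p) {w : α → F} (hw : MemLp w p μ) {E : Set α} (hE : MeasurableSet E)
    (hEfin : μ E ≠ ⊤) {M : ℝ} (hM : 0 ≤ M) {f : α → G}
    (h : ∀ᵐ x ∂μ, ‖f x‖ ≤ E.indicator (fun x => M * ‖w x‖) x) :
    ‖∫ x, f x ∂μ‖ ≤ M * ((eLpNorm w p μ).toReal * μ.real E ^ (1 - 1 / p.toReal)) := by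
  calc ‖∫ x, f x ∂μ‖ ≤ ∫ x, E.indicator (fun x => M * ‖w x‖) x ∂μ := by
        refine norm_integral_le_of_norm_le ?_ h
        rw [integrable_indicator_iff hE, IntegrableOn]
        have : Fact (μ E < ⊤) := ⟨hEfin.lt_top⟩
        exact ((hw.restrict _).integrable hp).norm.const_mul _
    _ = M * ∫ x in E, ‖w x‖ ∂μ := by rw [integral_indicator hE, integral_const_mul]
    _ ≤ _ := by
        gcongr
        exact setIntegral_norm_le_eLpNorm_mul hp hw hEfin

/-- The form in which Hölder ends both nonexistence proofs: `E` is the small set where the integrand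
lives and `M`, of order `1/s`, bounds the gradient of a cutoff at scale `s`. -/
theorem norm_setIntegral_le_mul_eLpNorm_mul_volume_rpow {n : ℕ} {G : Type*}
    [NormedAddCommGroup G] [NormedSpace ℝ G] {p : ℝ} (hp : 1 ≤ p) {Ω : Set (Euc n)}
    {w : Euc n → Euc n} (hw : MemLp w (ENNReal.ofReal p) (volume.restrict Ω)) {E : Set (Euc n)}
    (hE : MeasurableSet E) (hEfin : volume E ≠ ⊤) {M : ℝ} (hM : 0 ≤ M) {f : Euc n → G}
    (h : ∀ᵐ x ∂volume.restrict Ω, ‖f x‖ ≤ E.indicator (fun x => M * ‖w x‖) x) :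
    ‖∫ x in Ω, f x‖ ≤ M * ((eLpNorm w (ENNReal.ofReal p) (volume.restrict Ω)).toReal *
      volume.real E ^ (1 - 1 / p)) := by
  have hEfin' : volume.restrict Ω E ≠ ⊤ :=
    ((Measure.restrict_apply_le _ _).trans_lt hEfin.lt_top).ne
  refine (norm_integral_le_mul_eLpNorm_mul_measure_rpow (by simpa using hp) hw hE hEfin' hM
    h).trans ?_
  rw [ENNReal.toReal_ofReal (by linarith)]
  have hexp : 0 ≤ 1 - 1 / p := by
    rw [sub_nonneg, div_le_one (by linarith)]; exact hp
  gcongr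
  exact ENNReal.toReal_mono hEfin (Measure.restrict_apply_le _ _)

/-! ### The point source and its flux -/

/-- The point source `x / |x|ⁿ`. -/
noncomputable def pointSource (n : ℕ) (x : Euc n) : Euc n := (‖x‖ ^ 2) ^ (-(n : ℝ) / 2) • x

theorem norm_pointSource {n : ℕ} (x : Euc n) (hx : x ≠ 0) :
    ‖pointSource n x‖ = ‖x‖ ^ (1 - (n : ℝ)) := by
  have hx' : 0 < ‖x‖ := norm_pos_iff.2 hx
  rw [pointSource, norm_smul, Real.norm_of_nonneg (by positivity), ← Real.rpow_natCast,
    ← Real.rpow_mul hx'.le, ← Real.rpow_add_one hx'.ne']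
  congr 1
  push_cast
  ring

/-- The derivative `∂ᵢ(xᵢ|x|⁻ⁿ) = |x|⁻ⁿ - n|x|⁻ⁿ⁻² xᵢ²` sums to zero over `i`. Writing the field
with powers of `‖x‖ ^ 2` lets the chain rule start from the smooth squared norm. -/
theorem divFree_pointSource (n : ℕ) : DivFree {0}ᶜ (pointSource n) := by
  have hne : ∀ x ∈ ({0}ᶜ : Set (Euc n)), ‖x‖ ^ 2 ≠ 0 := fun x hx => by
    simpa using hx
  refine divFree_of_contDiffOn isOpen_compl_singleton ?_ fun x hx => ?_
  · intro x hx
    exact (((contDiff_norm_sq ℝ (n := 1)).contDiffAt.rpow_const_of_ne (hne x hx)).smul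
      contDiffAt_id).contDiffWithinAt
  · have h1 := ((hasStrictFDerivAt_norm_sq x).hasFDerivAt).rpow_const (p := -(n : ℝ) / 2)
      (Or.inl (hne x hx))
    have h2 : ∀ i, HasFDerivAt (fun y : Euc n => pointSource n y i) _ x := fun i =>
      h1.mul (EuclideanSpace.proj (𝕜 := ℝ) i).hasFDerivAt
    have h3 : ∀ i, fderiv ℝ (fun y : Euc n => pointSource n y i) x (EuclideanSpace.single i 1)
        = (‖x‖ ^ 2) ^ (-(n : ℝ) / 2)
          - n * (‖x‖ ^ 2) ^ (-(n : ℝ) / 2 - 1) * (x i) ^ 2 := fun i => by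
      rw [(h2 i).fderiv]
      simp [EuclideanSpace.inner_single_right]
      ring
    simp_rw [h3]
    rw [Finset.sum_sub_distrib, ← Finset.mul_sum, ← EuclideanSpace.real_norm_sq_eq]
    have h4 : (‖x‖ ^ 2) ^ (-(n : ℝ) / 2) = (‖x‖ ^ 2) ^ (-(n : ℝ) / 2 - 1) * ‖x‖ ^ 2 := by
      rw [← Real.rpow_add_one (hne x hx)]; congr 1; ring
    simp only [Finset.sum_const, Finset.card_univ, Fintype.card_fin, nsmul_eq_mul]
    rw [h4]
    ring

theorem measurable_pointSource (n : ℕ) : Measurable (pointSource n) := by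
  unfold pointSource
  fun_prop

/-- In polar coordinates the integral becomes that of `r^(n - 1 + (1 - n)p)` near `0`, and the
hypothesis says that this exponent exceeds `-1`. -/
theorem memLp_pointSource {n : ℕ} (hn : 1 ≤ n) {p : ℝ} (hp : 0 < p) (hpn : p * (n - 1) < n)
    (R : ℝ) :
    MemLp (pointSource n) (ENNReal.ofReal p) (volume.restrict (Metric.ball 0 R)) := by
  have : Nontrivial (Euc n) := by
    have : Nonempty (Fin n) := ⟨⟨0, hn⟩⟩
    infer_instance
  have hp0 : ENNReal.ofReal p ≠ 0 := by simpa using hp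
  rw [← integrable_norm_rpow_iff (measurable_pointSource n).aestronglyMeasurable hp0
    ENNReal.ofReal_ne_top, ENNReal.toReal_ofReal hp.le]
  have key : IntegrableOn (fun x : Euc n => (fun r : ℝ => r ^ ((1 - (n : ℝ)) * p)) ‖x‖)
      (Metric.ball 0 R) := by
    refine (integrableOn_fun_norm_addHaar volume (f := fun r : ℝ => r ^ ((1 - (n : ℝ)) * p))).2 ?_
    rcases le_or_gt R 0 with hR | hR
    · simp [Ioo_eq_empty_of_le hR]
    have : IntegrableOn (fun r : ℝ => r ^ ((n : ℝ) - 1 + (1 - (n : ℝ)) * p)) (Ioo 0 R) := by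
      rw [intervalIntegral.integrableOn_Ioo_rpow_iff hR]
      linarith
    refine this.congr_fun (fun r hr => ?_) measurableSet_Ioo
    simp only [finrank_euclideanSpace, Fintype.card_fin, smul_eq_mul]
    rw [Real.rpow_add hr.1, ← Real.rpow_natCast, Nat.cast_sub hn, Nat.cast_one]
  refine key.congr ?_
  have h0 : ∀ᵐ x : Euc n ∂volume.restrict (Metric.ball 0 R), x ≠ 0 :=
    ae_restrict_of_ae (Measure.ae_ne volume 0)
  filter_upwards [h0] with x hx
  rw [norm_pointSource x hx, ← Real.rpow_mul (norm_nonneg _)]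

/-- A smooth radial cutoff equal to `1` on the unit ball. -/
noncomputable def radialCutoff (n : ℕ) (x : Euc n) : ℝ := Real.smoothTransition (2 - ‖x‖ ^ 2)

theorem contDiff_radialCutoff (n : ℕ) : ContDiff ℝ ∞ (radialCutoff n) :=
  Real.smoothTransition.contDiff.comp (contDiff_const.sub (contDiff_norm_sq ℝ))

theorem radialCutoff_of_norm_le {n : ℕ} {x : Euc n} (hx : ‖x‖ ≤ 1) : radialCutoff n x = 1 :=
  Real.smoothTransition.one_of_one_le (by nlinarith [norm_nonneg x])

theorem tsupport_radialCutoff_subset (n : ℕ) :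
    tsupport (radialCutoff n) ⊆ Metric.closedBall 0 (3 / 2) := by
  refine closure_minimal (fun x hx => ?_) Metric.isClosed_closedBall
  rw [mem_closedBall_zero_iff]
  by_contra! h
  exact hx (Real.smoothTransition.zero_of_nonpos (by nlinarith))

theorem hasCompactSupport_radialCutoff (n : ℕ) : HasCompactSupport (radialCutoff n) :=
  (isCompact_closedBall _ _).of_isClosed_subset (isClosed_tsupport _)
    (tsupport_radialCutoff_subset n)

/-- The flux of the point source through spheres around the origin does not vanish. -/
theorem integral_fderiv_radialCutoff_ne_zero {n : ℕ} (hn : 1 ≤ n) :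
    ∫ x, fderiv ℝ (radialCutoff n) x (pointSource n x) ≠ 0 := by
  have : Nontrivial (Euc n) := by
    have : Nonempty (Fin n) := ⟨⟨0, hn⟩⟩
    infer_instance
  set S := Real.smoothTransition with hS
  have hSd : ContDiff ℝ 1 S := Real.smoothTransition.contDiff
  have hS' : Continuous (deriv S) := hSd.continuous_deriv le_rfl
  have h1 : ∀ x : Euc n, fderiv ℝ (radialCutoff n) x (pointSource n x)
      = (fun r : ℝ => -deriv S (2 - r ^ 2) * (2 * ((r ^ 2) ^ (-(n : ℝ) / 2) * r ^ 2))) ‖x‖ := by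
    intro x
    have hd : HasFDerivAt (radialCutoff n) _ x :=
      ((hSd.differentiable (by simp) (2 - ‖x‖ ^ 2)).hasDerivAt).comp_hasFDerivAt x
        ((hasStrictFDerivAt_norm_sq x).hasFDerivAt.const_sub 2)
    rw [hd.fderiv]
    simp [pointSource]
    ring
  rw [integral_congr_ae (.of_forall h1), integral_fun_norm_addHaar volume
    (fun r : ℝ => -deriv S (2 - r ^ 2) * (2 * ((r ^ 2) ^ (-(n : ℝ) / 2) * r ^ 2)))]
  have hderiv : ∀ r ∈ Ici (0 : ℝ), HasDerivAt (fun r : ℝ => S (2 - r ^ 2))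
      (-deriv S (2 - r ^ 2) * (2 * r)) r := by
    intro r _
    have := (hSd.differentiable (by simp) (2 - r ^ 2)).hasDerivAt.comp r
      (((hasDerivAt_id r).pow 2).const_sub 2)
    refine this.congr_deriv ?_
    simp
  have hz : ∀ r : ℝ, 2 < r → S (2 - r ^ 2) = 0 := fun r hr =>
    Real.smoothTransition.zero_of_nonpos (by nlinarith)
  have hdz : ∀ t : ℝ, t < 0 → deriv S t = 0 := fun t ht => by
    have : S =ᶠ[nhds t] fun _ => 0 := by
      filter_upwards [Iio_mem_nhds ht] with y hy
      exact Real.smoothTransition.zero_of_nonpos (le_of_lt hy)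
    rw [this.deriv_eq, deriv_const]
  have hint : Integrable (fun r : ℝ => -deriv S (2 - r ^ 2) * (2 * r)) := by
    refine Continuous.integrable_of_hasCompactSupport (by fun_prop) ?_
    refine HasCompactSupport.intro (isCompact_closedBall (0 : ℝ) 2) fun r hr => ?_
    rw [mem_closedBall_zero_iff, Real.norm_eq_abs, not_le] at hr
    rw [hdz _ (by nlinarith [sq_abs r])]
    simp
  have hlim : Filter.Tendsto (fun r : ℝ => S (2 - r ^ 2)) Filter.atTop (nhds 0) := by
    refine tendsto_const_nhds.congr' ?_
    filter_upwards [Filter.eventually_gt_atTop 2] with r hr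
    exact (hz r hr).symm
  have hI := integral_Ioi_of_hasDerivAt_of_tendsto' hderiv hint.integrableOn hlim
  have h2 : S (2 - 0 ^ 2) = 1 := Real.smoothTransition.one_of_one_le (by norm_num)
  rw [h2] at hI
  -- The polar weight `r^(n-1)` cancels the decay of the source, leaving exactly the derivative of
  -- `S (2 - r ^ 2)`, which drops from `1` at the origin to `0` at infinity.
  have hcongr : ∫ y in Ioi (0 : ℝ), y ^ (Module.finrank ℝ (Euc n) - 1) •
      (-deriv S (2 - y ^ 2) * (2 * ((y ^ 2) ^ (-(n : ℝ) / 2) * y ^ 2))) = 0 - 1 := by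
    rw [← hI]
    refine setIntegral_congr_fun measurableSet_Ioi fun r (hr : 0 < r) => ?_
    have e1 : (r ^ 2) ^ (-(n : ℝ) / 2) = (r ^ n)⁻¹ := by
      rw [← Real.rpow_natCast, ← Real.rpow_mul hr.le, ← Real.rpow_natCast, ← Real.rpow_neg hr.le]
      congr 1; push_cast; ring
    obtain ⟨k, rfl⟩ : ∃ k, n = k + 1 := ⟨n - 1, by omega⟩
    simp only [finrank_euclideanSpace, Fintype.card_fin, smul_eq_mul, Nat.add_sub_cancel]
    rw [e1]
    field_simp
    ring
  rw [hcongr]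
  have hV : (0 : ℝ) < volume.real (Metric.ball (0 : Euc n) 1) := by
    rw [Measure.real]
    exact ENNReal.toReal_pos (Metric.measure_ball_pos volume _ one_pos).ne'
      measure_ball_lt_top.ne
  simp only [finrank_euclideanSpace, Fintype.card_fin, smul_eq_mul, nsmul_eq_mul]
  have : (0 : ℝ) < n := by exact_mod_cast hn
  have := mul_pos this hV
  simp
  constructor
  · omega
  · exact hV.ne'

/-! ### Obstruction by a thin complement -/

/-- Applied at the tip, this gives room for test functions supported in small balls that also meet
the complement of the domain. -/
theorem ball_subset_thickening_of_mem_closure {X : Type*} [PseudoMetricSpace X] {s : Set X}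
    {x : X} (hx : x ∈ closure s) (η : ℝ) : Metric.ball x η ⊆ Metric.thickening η s := by
  rw [← Metric.thickening_closure, Metric.thickening_eq_biUnion_ball]
  exact subset_biUnion_of_mem (u := fun x => Metric.ball x η) hx

/-- Rescaled cutoffs have the same flux against the point source. -/
theorem integral_fderiv_eq_of_eqOn_ball {n : ℕ} {p : ℝ} (hn : 1 ≤ n) (hp : 1 ≤ p)
    (hpn : p * (n - 1) < n) {φ ψ : Euc n → ℝ} (hφ : ContDiff ℝ ∞ φ) (hφc : HasCompactSupport φ)
    (hψ : ContDiff ℝ ∞ ψ) (hψc : HasCompactSupport ψ) {r : ℝ} (hr : 0 < r)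
    (h : EqOn φ ψ (Metric.ball 0 r)) :
    ∫ x, fderiv ℝ φ x (pointSource n x) = ∫ x, fderiv ℝ ψ x (pointSource n x) := by
  have hp' : (1 : ℝ≥0∞) ≤ ENNReal.ofReal p := by simpa using hp
  have hint : ∀ φ : Euc n → ℝ, ContDiff ℝ ∞ φ → HasCompactSupport φ →
      Integrable (fun x => fderiv ℝ φ x (pointSource n x)) := by
    intro φ hφ hc
    obtain ⟨R, hR⟩ := hc.isCompact.isBounded.subset_ball (0 : Euc n)
    have h1 := integrable_fderiv_apply hp'
      (memLp_pointSource hn (by linarith) hpn R) hφ hc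
    refine (integrableOn_iff_integrable_of_support_subset ?_).1 h1
    intro x hx
    by_contra hxR
    refine hx ?_
    simp only
    rw [image_eq_zero_of_notMem_tsupport (f := fderiv ℝ φ)
      fun h => hxR (hR (tsupport_fderiv_subset ℝ h))]
    simp
  -- The difference of the cutoffs vanishes near `0`, so it is an admissible test function on the
  -- set where the source is solenoidal.
  have hs : tsupport (φ - ψ) ⊆ ({0}ᶜ : Set (Euc n)) := by
    intro x hx hx0
    rw [mem_singleton_iff] at hx0
    subst hx0
    refine (notMem_tsupport_iff_eventuallyEq.2 ?_) hx
    filter_upwards [Metric.ball_mem_nhds (0 : Euc n) hr] with y hy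
    simp [h hy]
  have h0 := divFree_pointSource n (φ - ψ) (hφ.sub hψ) (hφc.sub hψc) hs
  have hnt : Nontrivial (Euc n) := by
    have : Nonempty (Fin n) := ⟨⟨0, hn⟩⟩
    infer_instance
  rw [restrict_compl_singleton] at h0
  rw [← sub_eq_zero, ← integral_sub (hint φ hφ hφc) (hint ψ hψ hψc), ← h0]
  refine integral_congr_ae (.of_forall fun x => ?_)
  simp only
  rw [fderiv_sub (hφ.differentiable (by simp) x) (hψ.differentiable (by simp) x)]
  simp

/-- If the complement of `Ω` is too thin near the boundary point `0`, then the flux emitted by a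
point source at `0` cannot return to `0` inside the complement. -/
theorem not_hasSolenoidalExtension_of_thin_compl {n : ℕ} (hn : 1 ≤ n) {p : ℝ} (hp : 1 ≤ p)
    (hpn : p * (n - 1) < n) [Fact (1 ≤ ENNReal.ofReal p)] {Ω : Set (Euc n)} (hΩ : IsOpen Ω)
    (hb : Bornology.IsBounded Ω) (h0 : (0 : Euc n) ∉ Ω) (h0c : (0 : Euc n) ∈ closure Ω)
    (hthin : Filter.Tendsto
      (fun s : ℝ => s⁻¹ * volume.real (Metric.ball 0 (2 * s) \ Ω) ^ (1 - 1 / p))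
      (nhdsWithin 0 (Ioi 0)) (nhds 0))
    {η : ℝ} (hη : 0 < η) :
    ¬ HasSolenoidalExtension (ENNReal.ofReal p) Ω (Metric.thickening η Ω) := by
  intro hext
  have hp' : (1 : ℝ≥0∞) ≤ ENNReal.ofReal p := Fact.out
  set Ω' := Metric.thickening η Ω with hΩ'
  have hsub : Ω ⊆ Ω' := Metric.self_subset_thickening hη Ω
  obtain ⟨R, hR⟩ := (hb.thickening (δ := η)).subset_ball (0 : Euc n)
  have hu' : MemLp (pointSource n) (ENNReal.ofReal p) (volume.restrict Ω') :=
    (memLp_pointSource hn (by linarith) hpn R).mono_measure (Measure.restrict_mono hR le_rfl)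
  have hu : MemLp (pointSource n) (ENNReal.ofReal p) (volume.restrict Ω) :=
    hu'.mono_measure (Measure.restrict_mono hsub le_rfl)
  obtain ⟨v, hv, hvd, hvu⟩ := hext.exists_extension hu
    ((divFree_pointSource n).mono fun x hx => by rintro rfl; exact h0 hx)
  set w := v - pointSource n with hw
  have hwm : MemLp w (ENNReal.ofReal p) (volume.restrict Ω') := hv.sub hu'
  set φ := radialCutoff n with hφdef
  have hφ : ContDiff ℝ ∞ φ := contDiff_radialCutoff n
  have hφc : HasCompactSupport φ := hasCompactSupport_radialCutoff n
  obtain ⟨C, hC⟩ := (hφc.fderiv (𝕜 := ℝ)).exists_bound_of_continuous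
    (hφ.continuous_fderiv (by simp))
  set c := ∫ x, fderiv ℝ φ x (pointSource n x) with hc
  have hc0 : c ≠ 0 := integral_fderiv_radialCutoff_ne_zero hn
  set N := (eLpNorm w (ENNReal.ofReal p) (volume.restrict Ω')).toReal with hN
  have hbound : ∀ s : ℝ, 0 < s → 2 * s < η →
      |c| ≤ C * N * (s⁻¹ * volume.real (Metric.ball 0 (2 * s) \ Ω) ^ (1 - 1 / p)) := by
    intro s hs hsη
    set φs : Euc n → ℝ := fun x => φ (s⁻¹ • x) with hφs
    have hφs1 : ContDiff ℝ ∞ φs := hφ.comp (contDiff_const_smul _)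
    have hφs2 : HasCompactSupport φs := hφc.comp_smul (inv_ne_zero hs.ne')
    have hball : tsupport φs ⊆ Metric.ball 0 (2 * s) := by
      refine (closure_minimal (t := Metric.closedBall 0 (3 / 2 * s)) (fun x hx => ?_)
        Metric.isClosed_closedBall).trans (Metric.closedBall_subset_ball (by linarith))
      have := tsupport_radialCutoff_subset n (subset_tsupport _ hx)
      rw [mem_closedBall_zero_iff, norm_smul, norm_inv, Real.norm_of_nonneg hs.le,
        inv_mul_le_iff₀ hs] at this
      rw [mem_closedBall_zero_iff]
      linarith
    have hballΩ' : Metric.ball (0 : Euc n) (2 * s) ⊆ Ω' :=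
      (Metric.ball_subset_ball hsη.le).trans (ball_subset_thickening_of_mem_closure h0c η)
    have hz : ∀ x, x ∉ Metric.ball (0 : Euc n) (2 * s) → fderiv ℝ φs x = 0 := fun x hx =>
      image_eq_zero_of_notMem_tsupport fun h => hx (hball (tsupport_fderiv_subset ℝ h))
    have hflux : ∫ x in Ω', fderiv ℝ φs x (pointSource n x) = c := by
      rw [setIntegral_eq_integral_of_forall_compl_eq_zero fun x hx => by
        rw [hz x fun h => hx (hballΩ' h)]; simp]
      refine integral_fderiv_eq_of_eqOn_ball hn hp hpn hφs1 hφs2 hφ hφc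
        (r := min 1 s) (lt_min one_pos hs) fun x hx => ?_
      rw [mem_ball_zero_iff, lt_min_iff] at hx
      rw [hφdef, radialCutoff_of_norm_le hx.1.le, hφs]
      refine radialCutoff_of_norm_le ?_
      rw [norm_smul, norm_inv, Real.norm_of_nonneg hs.le, inv_mul_le_iff₀ hs]
      linarith [hx.2]
    -- The extension has zero flux, so the correction `w` must cancel the whole flux of the source,
    -- at every scale.
    have hwint : ∫ x in Ω', fderiv ℝ φs x (w x) = -c := by
      have h1 := integral_sub (integrable_fderiv_apply hp' hv hφs1 hφs2)
        (integrable_fderiv_apply hp' hu' hφs1 hφs2)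
      rw [hvd φs hφs1 hφs2 (hball.trans hballΩ'), hflux, zero_sub] at h1
      rw [← h1]
      simp [hw]
    have hE : MeasurableSet (Metric.ball (0 : Euc n) (2 * s) \ Ω) :=
      measurableSet_ball.diff hΩ.measurableSet
    -- The gradient of `φs` vanishes off the ball and `w` vanishes a.e. in `Ω`, so only the thin set
    -- contributes; rescaling costs the factor `s⁻¹`.
    have hpt : ∀ᵐ x ∂volume.restrict Ω', ‖fderiv ℝ φs x (w x)‖ ≤
        (Metric.ball (0 : Euc n) (2 * s) \ Ω).indicator (fun x => C * s⁻¹ * ‖w x‖) x := by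
      have hw0 : ∀ᵐ x, x ∈ Ω → w x = 0 := by
        rw [← ae_restrict_iff' hΩ.measurableSet]
        filter_upwards [hvu] with x hx
        simp [hw, hx]
      filter_upwards [ae_restrict_of_ae hw0] with x hx
      by_cases hxE : x ∈ Metric.ball (0 : Euc n) (2 * s) \ Ω
      · rw [indicator_of_mem hxE]
        refine ((fderiv ℝ φs x).le_opNorm _).trans ?_
        gcongr
        rw [hφs, fderiv_comp_smul, norm_smul, norm_inv, Real.norm_of_nonneg hs.le, mul_comm]
        gcongr
        exact hC _
      · rw [indicator_of_notMem hxE]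
        by_cases hxb : x ∈ Metric.ball (0 : Euc n) (2 * s)
        · rw [hx (by_contra fun h => hxE ⟨hxb, h⟩)]
          simp
        · rw [hz x hxb]
          simp
    have hEfin : volume (Metric.ball (0 : Euc n) (2 * s) \ Ω) ≠ ⊤ :=
      ((measure_mono sdiff_subset).trans_lt measure_ball_lt_top).ne
    have hC0 : 0 ≤ C := (norm_nonneg _).trans (hC 0)
    have := norm_setIntegral_le_mul_eLpNorm_mul_volume_rpow hp hwm hE hEfin
      (mul_nonneg hC0 (inv_nonneg.2 hs.le)) hpt
    rw [hwint, norm_neg, Real.norm_eq_abs] at this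
    exact this.trans_eq (by ring)
  have hlim := hthin.const_mul (C * N)
  rw [mul_zero] at hlim
  have hle : |c| ≤ 0 := by
    refine ge_of_tendsto hlim ?_
    filter_upwards [self_mem_nhdsWithin,
      mem_nhdsWithin_of_mem_nhds (Iio_mem_nhds (show (0 : ℝ) < η / 2 by linarith))] with s hs hs'
    exact hbound s hs (by linarith [mem_Iio.1 hs'])
  exact hc0 (abs_nonpos_iff.1 hle)

/-! ### The cusps as bounded open sets, and nonexistence for inward cusps -/

theorem cuspProfile_eq_max_rpow {γ : ℝ} (hγ : 0 < γ) (s : ℝ) :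
    cuspProfile γ s = max s 0 ^ γ := by
  unfold cuspProfile
  split_ifs with h
  · rw [max_eq_left h.le]
  · rw [max_eq_right (not_lt.1 h), Real.zero_rpow hγ.ne']

theorem continuous_cuspProfile {γ : ℝ} (hγ : 0 < γ) : Continuous (cuspProfile γ) := by
  have : cuspProfile γ = fun s => max s 0 ^ γ := funext (cuspProfile_eq_max_rpow hγ)
  rw [this]
  exact (continuous_id.max continuous_const).rpow_const fun _ => Or.inr hγ.le

theorem cuspProfile_of_nonneg {γ s : ℝ} (hγ : 0 < γ) (hs : 0 ≤ s) : cuspProfile γ s = s ^ γ := by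
  rw [cuspProfile_eq_max_rpow hγ, max_eq_left hs]

theorem continuous_horizontal (m : ℕ) : Continuous (horizontal (m := m)) := by
  unfold horizontal
  fun_prop

theorem isOpen_forall_mem_Ioo (n : ℕ) : IsOpen {x : Euc n | ∀ i, x i ∈ Ioo (-1 : ℝ) 1} := by
  simp only [ofPred_forall]
  exact isOpen_iInter_of_finite fun i => isOpen_Ioo.preimage (EuclideanSpace.proj i).continuous

theorem isOpen_inwardCusp {γ : ℝ} (hγ : 0 < γ) (m : ℕ) : IsOpen (inwardCusp m γ) :=
  (isOpen_forall_mem_Ioo (m + 1)).inter (isOpen_lt (EuclideanSpace.proj _).continuous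
    ((continuous_cuspProfile hγ).comp (continuous_horizontal m).norm))

theorem isOpen_outwardCusp {γ : ℝ} (hγ : 0 < γ) (m : ℕ) : IsOpen (outwardCusp m γ) :=
  (isOpen_forall_mem_Ioo (m + 1)).inter
    (isOpen_lt ((continuous_cuspProfile hγ).comp (continuous_horizontal m).norm)
      (EuclideanSpace.proj _).continuous)

theorem isBounded_forall_mem_Ioo (n : ℕ) :
    Bornology.IsBounded {x : Euc n | ∀ i, x i ∈ Ioo (-1 : ℝ) 1} := by
  refine (Metric.isBounded_closedBall (x := (0 : Euc n)) (r := √n)).subset fun x hx => ?_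
  rw [mem_closedBall_zero_iff, EuclideanSpace.norm_eq]
  refine Real.sqrt_le_sqrt ?_
  calc ∑ i, ‖x i‖ ^ 2 ≤ ∑ _i : Fin n, (1 : ℝ) := by
        refine Finset.sum_le_sum fun i _ => ?_
        rw [sq_le_one_iff₀ (norm_nonneg _), Real.norm_eq_abs, abs_le]
        exact ⟨(hx i).1.le, (hx i).2.le⟩
    _ = n := by simp

/-- The volume of an axis-parallel cylinder over a cube. -/
theorem volume_real_box (m : ℕ) {a b : ℝ} (ha : 0 ≤ a) (hb : 0 ≤ b) :
    volume.real {x : Euc (m + 1) | (∀ i : Fin m, |x i.castSucc| ≤ a) ∧ |x (Fin.last m)| ≤ b}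
      = (2 * a) ^ m * (2 * b) := by
  set c : Fin (m + 1) → ℝ := Fin.snoc (fun _ => a) b with hc
  have h1 : {x : Euc (m + 1) | (∀ i : Fin m, |x i.castSucc| ≤ a) ∧ |x (Fin.last m)| ≤ b}
      = WithLp.ofLp ⁻¹' (Icc (-c) c) := by
    ext x
    simp only [mem_ofPred_eq, mem_preimage, mem_Icc, Pi.le_def, Fin.forall_fin_succ', Pi.neg_apply,
      hc, Fin.snoc_castSucc, Fin.snoc_last, abs_le]
    grind
  rw [h1, Measure.real, (PiLp.volume_preserving_ofLp (Fin (m + 1))).measure_preimage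
    measurableSet_Icc.nullMeasurableSet, Real.volume_Icc_pi_toReal]
  · rw [Fin.prod_univ_castSucc]
    simp [hc]
    ring
  · intro i
    refine Fin.lastCases ?_ (fun j => ?_) i <;> simp [hc] <;> linarith

theorem abs_le_norm_horizontal {m : ℕ} (x : Euc (m + 1)) (i : Fin m) :
    |x i.castSucc| ≤ ‖horizontal x‖ := by
  simpa [horizontal] using PiLp.norm_apply_le (horizontal x) i

/-- For `s < 1` the ball lies inside the cube, so a point of it outside the domain satisfies `|x'|^γ
≤ y ≤ s`. It therefore lies in a box with horizontal half-side `s^(1/γ)` and vertical half-side `s`.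
-/
theorem volume_real_ball_sdiff_inwardCusp_le {γ : ℝ} (hγ : 0 < γ) (m : ℕ) {s : ℝ} (hs : 0 < s)
    (hs1 : s < 1) :
    volume.real (Metric.ball 0 s \ inwardCusp m γ) ≤ (2 * s ^ γ⁻¹) ^ m * (2 * s) := by
  rw [← volume_real_box m (by positivity) hs.le]
  have hbox : {x : Euc (m + 1) | (∀ i : Fin m, |x i.castSucc| ≤ s ^ γ⁻¹) ∧ |x (Fin.last m)| ≤ s}
      ⊆ Metric.closedBall 0 (√(∑ _i : Fin (m + 1), (max (s ^ γ⁻¹) s) ^ 2)) := by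
    intro x hx
    rw [mem_closedBall_zero_iff, EuclideanSpace.norm_eq]
    refine Real.sqrt_le_sqrt (Finset.sum_le_sum fun i _ => ?_)
    gcongr
    refine Fin.lastCases ?_ (fun j => ?_) i
    · exact hx.2.trans (le_max_right _ _)
    · exact (hx.1 j).trans (le_max_left _ _)
  refine measureReal_mono ?_ ((measure_mono hbox).trans_lt measure_closedBall_lt_top).ne
  rintro x ⟨hx, hxΩ⟩
  rw [mem_ball_zero_iff] at hx
  have hi : ∀ i, |x i| ≤ ‖x‖ := fun i => PiLp.norm_apply_le x i
  have hcube : ∀ i, x i ∈ Ioo (-1 : ℝ) 1 := fun i => by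
    rw [mem_Ioo, ← abs_lt]
    linarith [hi i]
  have hy : cuspProfile γ ‖horizontal x‖ ≤ x (Fin.last m) := by
    by_contra! h
    exact hxΩ ⟨hcube, h⟩
  rw [cuspProfile_of_nonneg hγ (norm_nonneg _)] at hy
  have hys : ‖horizontal x‖ ^ γ ≤ s :=
    hy.trans ((le_abs_self _).trans ((hi _).trans hx.le))
  refine ⟨fun i => (abs_le_norm_horizontal x i).trans ?_, (hi _).trans hx.le⟩
  exact (Real.le_rpow_inv_iff_of_pos (norm_nonneg _) hs.le hγ).2 hys

theorem zero_mem_closure_inwardCusp {γ : ℝ} (m : ℕ) : (0 : Euc (m + 1)) ∈ closure (inwardCusp m γ) := by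
  rw [Metric.mem_closure_iff]
  intro ε hε
  set t := min (ε / 2) (1 / 2) with ht
  have ht0 : 0 < t := by positivity
  have ht1 : t < 1 := (min_le_right _ _).trans_lt (by norm_num)
  refine ⟨EuclideanSpace.single (Fin.last m) (-t), ⟨fun i => ?_, ?_⟩, ?_⟩
  · refine Fin.lastCases ?_ (fun j => ?_) i
    · simp only [PiLp.single_apply, if_true, mem_Ioo]
      constructor <;> linarith
    · simp [(Fin.castSucc_lt_last j).ne]
  · have : horizontal (EuclideanSpace.single (Fin.last m) (-t)) = 0 := by
      ext i
      simp [horizontal]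
    rw [this]
    simp [cuspProfile, ht0]
  · rw [dist_zero_left, PiLp.norm_single, norm_neg, Real.norm_of_nonneg ht0.le]
    exact (min_le_left _ _).trans_lt (by linarith)

theorem inwardCusp_not_hasSolenoidalExtension {m : ℕ} (hm : 1 ≤ m) {γ : ℝ} (hγ : 0 < γ)
    (hγ1 : γ < 1) :
    ∃ (p : ℝ≥0∞) (_ : Fact (1 ≤ p)), 1 < p ∧ p < ⊤ ∧
      ∀ η : ℝ, 0 < η →
        ¬ HasSolenoidalExtension p (inwardCusp m γ)
            (Metric.thickening η (inwardCusp m γ)) := by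
  have hm0 : (0 : ℝ) < m := by exact_mod_cast hm
  -- This makes `m(p - 1)` the midpoint of `γ` and `1`: below `1` for integrability of the source,
  -- above `γ` for decay of the spike's contribution.
  set p : ℝ := 1 + (γ + 1) / (2 * m) with hp
  have hp1 : 1 < p := by
    have : 0 < (γ + 1) / (2 * m) := by positivity
    linarith
  have hpm : m * (p - 1) = (γ + 1) / 2 := by rw [hp]; field_simp; ring
  have hp' : 1 < ENNReal.ofReal p := by simpa using hp1
  refine ⟨ENNReal.ofReal p, ⟨hp'.le⟩, hp', ENNReal.ofReal_lt_top, fun η hη => ?_⟩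
  have : Fact (1 ≤ ENNReal.ofReal p) := ⟨hp'.le⟩
  refine not_hasSolenoidalExtension_of_thin_compl (by omega) hp1.le ?_ (isOpen_inwardCusp hγ m)
    ((isBounded_forall_mem_Ioo (m + 1)).subset fun x hx => hx.1) ?_
    (zero_mem_closure_inwardCusp m) ?_ hη
  · push_cast
    nlinarith
  · intro h
    have := h.2
    have h0 : horizontal (0 : Euc (m + 1)) = 0 := by ext i; simp [horizontal]
    rw [h0] at this
    simp [cuspProfile] at this
  · set q : ℝ := 1 - 1 / p with hq
    have hq0 : 0 < q := by
      rw [hq, sub_pos, div_lt_one (by linarith)]; exact hp1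
    set e : ℝ := (γ⁻¹ * m + 1) * q - 1 with he
    have he0 : 0 < e := by
      have h1 : 1 < γ⁻¹ * (m * (p - 1)) := by
        rw [hpm, lt_inv_mul_iff₀ hγ]; linarith
      have h2 : e = (γ⁻¹ * (m * (p - 1)) - 1) / p := by
        rw [he, hq]; field_simp; ring
      rw [h2]
      exact div_pos (by linarith) (by linarith)
    set K : ℝ := (2 ^ m * 2) ^ q * 2 ^ ((γ⁻¹ * m + 1) * q) with hK
    have hlim : Filter.Tendsto (fun s : ℝ => K * s ^ e) (nhdsWithin 0 (Ioi 0)) (nhds 0) := by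
      have : ContinuousAt (fun s : ℝ => K * s ^ e) 0 :=
        (Real.continuousAt_rpow_const 0 e (Or.inr he0.le)).const_mul K
      have h := this.tendsto.mono_left (nhdsWithin_le_nhds (s := Ioi 0))
      simpa [Real.zero_rpow he0.ne'] using h
    refine squeeze_zero' ?_ ?_ hlim
    · filter_upwards [self_mem_nhdsWithin] with s hs
      have : (0 : ℝ) < s := hs
      positivity
    · filter_upwards [self_mem_nhdsWithin, mem_nhdsWithin_of_mem_nhds
        (Iio_mem_nhds (show (0 : ℝ) < 1 / 2 by norm_num))] with s hs hs'
      have hs0 : (0 : ℝ) < s := hs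
      have hs1 : 2 * s < 1 := by linarith [mem_Iio.1 hs']
      calc s⁻¹ * volume.real (Metric.ball 0 (2 * s) \ inwardCusp m γ) ^ q
          ≤ s⁻¹ * ((2 * (2 * s) ^ γ⁻¹) ^ m * (2 * (2 * s))) ^ q := by
            gcongr
            exact volume_real_ball_sdiff_inwardCusp_le hγ m (by positivity) hs1
        _ = s⁻¹ * ((2 ^ m * 2) * (2 * s) ^ (γ⁻¹ * m + 1)) ^ q := by
            congr 2
            rw [Real.rpow_add_one (by positivity), Real.rpow_mul (by positivity),
              Real.rpow_natCast, mul_pow]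
            ring
        _ = K * s ^ e := by
            rw [Real.mul_rpow (by positivity) (by positivity), ← Real.rpow_mul (by positivity),
              Real.mul_rpow (by norm_num) hs0.le, he, Real.rpow_sub_one hs0.ne', hK]
            ring

/-! ### Nonexistence for outward cusps in the plane -/

/-- The shear flow `(1 / y, 0)` in the plane. -/
noncomputable def shearFlow (x : Euc 2) : Euc 2 := (x 1)⁻¹ • EuclideanSpace.single 0 1

theorem norm_horizontal_one (x : Euc 2) : ‖horizontal (m := 1) x‖ = |x 0| := by
  rw [EuclideanSpace.norm_eq]
  simp [horizontal, Real.sqrt_sq_eq_abs]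

theorem mem_outwardCusp_one {γ : ℝ} (hγ : 0 < γ) {x : Euc 2} :
    x ∈ outwardCusp 1 γ ↔ |x 0| < 1 ∧ 0 < x 1 ∧ x 1 < 1 ∧ |x 0| < x 1 ^ γ⁻¹ := by
  have h : x ∈ outwardCusp 1 γ ↔ (∀ i, x i ∈ Ioo (-1 : ℝ) 1) ∧ |x 0| ^ γ < x 1 := by
    rw [← cuspProfile_of_nonneg hγ (abs_nonneg _), ← norm_horizontal_one]
    rfl
  rw [h, Fin.forall_fin_two, abs_lt]
  constructor
  · rintro ⟨⟨h0, h1⟩, h2⟩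
    have h3 : 0 < x 1 := (by positivity : 0 ≤ |x 0| ^ γ).trans_lt h2
    exact ⟨h0, h3, h1.2, (Real.lt_rpow_inv_iff_of_pos (abs_nonneg _) h3.le hγ).2 h2⟩
  · rintro ⟨h0, h1, h2, h3⟩
    exact ⟨⟨h0, by linarith, h2⟩, (Real.lt_rpow_inv_iff_of_pos (abs_nonneg _) h1.le hγ).1 h3⟩

theorem divFree_shearFlow : DivFree {x : Euc 2 | 0 < x 1} shearFlow := by
  have hd : ∀ i : Fin 2, ContDiff ℝ 1 (fun x : Euc 2 => x i) := fun i =>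
    (EuclideanSpace.proj (𝕜 := ℝ) i).contDiff
  refine divFree_of_contDiffOn (isOpen_lt continuous_const (EuclideanSpace.proj _).continuous)
    ?_ fun x hx => ?_
  · rw [contDiffOn_euclidean]
    rw [Fin.forall_fin_two]
    constructor
    · simp only [shearFlow, PiLp.smul_apply, PiLp.single_apply, if_true, smul_eq_mul, mul_one]
      exact (hd 1).contDiffOn.inv fun x hx => ne_of_gt hx
    · simp [shearFlow, contDiffOn_const]
  · rw [Fin.sum_univ_two]
    have h0 : HasFDerivAt (fun y : Euc 2 => shearFlow y 0) _ x :=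
      (hasDerivAt_inv (ne_of_gt hx)).comp_hasFDerivAt x
        (EuclideanSpace.proj (𝕜 := ℝ) (1 : Fin 2)).hasFDerivAt |>.congr_of_eventuallyEq
        (.of_forall fun y => by simp [shearFlow])
    have h1 : (fun y : Euc 2 => shearFlow y 1) = fun _ => 0 := by
      ext y; simp [shearFlow]
    rw [h0.fderiv, h1]
    simp

/-- The identification of the plane with `ℝ × ℝ`. -/
theorem measurePreserving_coords :
    MeasurePreserving (fun x : Euc 2 => (x 0, x 1)) :=
  (volume_preserving_finTwoArrow ℝ).comp (PiLp.volume_preserving_ofLp (Fin 2))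

theorem measurableEmbedding_coords : MeasurableEmbedding (fun x : Euc 2 => (x 0, x 1)) :=
  (MeasurableEquiv.finTwoArrow (α := ℝ)).measurableEmbedding.comp
    (MeasurableEquiv.toLp 2 (Fin 2 → ℝ)).symm.measurableEmbedding

/-- The slice of the cusp at height `b` has length at most `2 b^(1/γ)`, which reduces the claim to
integrability of `b^(1/γ - p)` on `(0, 1)`. -/
theorem memLp_shearFlow {γ : ℝ} (hγ : 0 < γ) {p : ℝ} (hp : 0 < p) (hpγ : p < 1 + γ⁻¹) :
    MemLp shearFlow (ENNReal.ofReal p) (volume.restrict (outwardCusp 1 γ)) := by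
  have hmeas : Measurable shearFlow := by
    unfold shearFlow
    exact (EuclideanSpace.proj (𝕜 := ℝ) (1 : Fin 2)).continuous.measurable.inv.smul_const _
  refine ⟨hmeas.aestronglyMeasurable, ?_⟩
  rw [eLpNorm_lt_top_iff_lintegral_rpow_enorm_lt_top (by simpa using hp) ENNReal.ofReal_ne_top,
    ENNReal.toReal_ofReal hp.le]
  set A : Set (ℝ × ℝ) := {z | 0 < z.2 ∧ z.2 < 1 ∧ |z.1| ≤ z.2 ^ γ⁻¹} with hA
  have hAm : MeasurableSet A := by
    exact (measurableSet_lt measurable_const measurable_snd).inter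
      ((measurableSet_lt measurable_snd measurable_const).inter
        (measurableSet_le (f := fun z : ℝ × ℝ => |z.1|) (g := fun z : ℝ × ℝ => z.2 ^ γ⁻¹)
          (by fun_prop) (by fun_prop)))
  set F : ℝ × ℝ → ℝ≥0∞ := A.indicator fun z => ENNReal.ofReal (z.2 ^ (-p)) with hF
  have hFm : Measurable F := by
    refine Measurable.indicator ?_ hAm
    fun_prop
  calc ∫⁻ x in outwardCusp 1 γ, ‖shearFlow x‖ₑ ^ p
      ≤ ∫⁻ x in outwardCusp 1 γ, F (x 0, x 1) := by
        refine setLIntegral_mono' (isOpen_outwardCusp hγ 1).measurableSet fun x hx => ?_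
        obtain ⟨-, h1, h2, h3⟩ := (mem_outwardCusp_one hγ).1 hx
        rw [hF, indicator_of_mem (show (x 0, x 1) ∈ A from ⟨h1, h2, h3.le⟩)]
        rw [← ofReal_norm, ENNReal.ofReal_rpow_of_nonneg (norm_nonneg _) hp.le]
        refine ENNReal.ofReal_le_ofReal (le_of_eq ?_)
        rw [shearFlow, norm_smul, PiLp.norm_single, norm_one, mul_one, Real.norm_of_nonneg (inv_nonneg.2 h1.le),
          Real.inv_rpow h1.le, Real.rpow_neg h1.le]
    _ ≤ ∫⁻ x : Euc 2, F (x 0, x 1) := setLIntegral_le_lintegral _ _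
    _ = ∫⁻ z, F z := measurePreserving_coords.lintegral_comp hFm
    _ = ∫⁻ b, ∫⁻ a, F (a, b) := by
        rw [Measure.volume_eq_prod, lintegral_prod_symm' _ hFm]
    _ = ∫⁻ b in Ioo (0 : ℝ) 1, ENNReal.ofReal (2 * b ^ (γ⁻¹ - p)) := by
        rw [← lintegral_indicator measurableSet_Ioo]
        refine lintegral_congr fun b => ?_
        by_cases hb : b ∈ Ioo (0 : ℝ) 1
        · rw [indicator_of_mem hb]
          have : (fun a => F (a, b)) = (Icc (-(b ^ γ⁻¹)) (b ^ γ⁻¹)).indicator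
              fun _ => ENNReal.ofReal (b ^ (-p)) := by
            ext a
            simp only [hF, hA, indicator, mem_ofPred_eq, mem_Icc, abs_le, hb.1, hb.2, true_and]
          rw [this, lintegral_indicator measurableSet_Icc, setLIntegral_const, Real.volume_Icc,
            ← ENNReal.ofReal_mul (by have := hb.1; positivity), sub_eq_add_neg γ⁻¹ p,
            Real.rpow_add hb.1]
          congr 1
          ring
        · rw [indicator_of_notMem hb]
          refine lintegral_eq_zero_of_ae_eq_zero (.of_forall fun a => ?_)
          refine indicator_of_notMem (fun h => hb ⟨h.1, h.2.1⟩) _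
    _ < ⊤ := by
        have h1 : IntegrableOn (fun b : ℝ => 2 * b ^ (γ⁻¹ - p)) (Ioo 0 1) :=
          ((intervalIntegral.integrableOn_Ioo_rpow_iff one_pos).2 (by linarith)).const_mul 2
        have h2 := h1.hasFiniteIntegral
        rw [hasFiniteIntegral_iff_ofReal] at h2
        · exact h2
        · filter_upwards [ae_restrict_mem measurableSet_Ioo] with b hb
          have := hb.1
          positivity

theorem zero_mem_closure_outwardCusp_one {γ : ℝ} (hγ : 0 < γ) :
    (0 : Euc 2) ∈ closure (outwardCusp 1 γ) := by
  rw [Metric.mem_closure_iff]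
  intro ε hε
  set t := min (ε / 2) (1 / 2) with ht
  have ht0 : 0 < t := by positivity
  have ht1 : t < 1 := (min_le_right _ _).trans_lt (by norm_num)
  refine ⟨EuclideanSpace.single 1 t, (mem_outwardCusp_one hγ).2 ?_, ?_⟩
  · simp [ht0, ht1, Real.rpow_pos_of_pos]
  · rw [dist_zero_left, PiLp.norm_single, Real.norm_of_nonneg ht0.le]
    exact (min_le_left _ _).trans_lt (by linarith)

theorem deriv_smoothTransition_eq_zero {t : ℝ} (ht : t ∉ Icc (0 : ℝ) 1) :
    deriv Real.smoothTransition t = 0 := by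
  rw [mem_Icc, not_and_or, not_le, not_le] at ht
  rcases ht with ht | ht
  · have : Real.smoothTransition =ᶠ[nhds t] fun _ => 0 := by
      filter_upwards [Iio_mem_nhds ht] with y hy
      exact Real.smoothTransition.zero_of_nonpos (le_of_lt hy)
    rw [this.deriv_eq, deriv_const]
  · have : Real.smoothTransition =ᶠ[nhds t] fun _ => 1 := by
      filter_upwards [Ioi_mem_nhds ht] with y hy
      exact Real.smoothTransition.one_of_one_le (le_of_lt hy)
    rw [this.deriv_eq, deriv_const]

theorem continuous_deriv_smoothTransition : Continuous (deriv Real.smoothTransition) :=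
  (Real.smoothTransition.contDiff (n := 1)).continuous_deriv le_rfl

theorem integrable_deriv_smoothTransition : Integrable (deriv Real.smoothTransition) :=
  continuous_deriv_smoothTransition.integrable_of_hasCompactSupport
    (HasCompactSupport.intro isCompact_Icc fun _ hx => deriv_smoothTransition_eq_zero hx)

theorem integral_deriv_smoothTransition : ∫ t, deriv Real.smoothTransition t = 1 := by
  have hbot : Filter.Tendsto Real.smoothTransition Filter.atBot (nhds 0) := by
    refine tendsto_const_nhds.congr' ?_
    filter_upwards [Filter.eventually_le_atBot 0] with r hr
    exact (Real.smoothTransition.zero_of_nonpos hr).symm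
  have htop : Filter.Tendsto Real.smoothTransition Filter.atTop (nhds 1) := by
    refine tendsto_const_nhds.congr' ?_
    filter_upwards [Filter.eventually_ge_atTop 1] with r hr
    exact (Real.smoothTransition.one_of_one_le hr).symm
  have := integral_of_hasDerivAt_of_tendsto (fun x =>
    ((Real.smoothTransition.contDiff (n := 1)).differentiable (by simp) x).hasDerivAt)
    integrable_deriv_smoothTransition hbot htop
  simpa using this

/-- A plateau around `0` in the line. -/
noncomputable def plateau : ContDiffBump (0 : ℝ) := ⟨1, 2, by norm_num, by norm_num⟩

/-- A bump around `2` in the line. -/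
noncomputable def heightBump : ContDiffBump (2 : ℝ) := ⟨1 / 2, 1, by norm_num, by norm_num⟩

theorem plateau_eq_one {t : ℝ} (ht : |t| ≤ 1) : plateau t = 1 :=
  plateau.one_of_mem_closedBall (by simpa [plateau] using ht)

theorem plateau_eq_zero {t : ℝ} (ht : 2 ≤ |t|) : plateau t = 0 :=
  plateau.zero_of_le_dist (by simpa [plateau] using ht)

theorem heightBump_eq_zero {t : ℝ} (ht : t ∉ Ioo (1 : ℝ) 3) : heightBump t = 0 := by
  refine heightBump.zero_of_le_dist ?_
  simp only [heightBump, Real.dist_eq]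
  by_contra! h
  rw [abs_lt] at h
  exact ht ⟨by linarith, by linarith⟩

/-- The two-dimensional cutoff living around the point `(0, 2)`. -/
noncomputable def cuspCutoff (x : Euc 2) : ℝ := plateau (x 0) * heightBump (x 1)

theorem contDiff_coord (i : Fin 2) : ContDiff ℝ ∞ (fun x : Euc 2 => x i) :=
  (EuclideanSpace.proj (𝕜 := ℝ) i).contDiff

theorem contDiff_cuspCutoff : ContDiff ℝ ∞ cuspCutoff :=
  (plateau.contDiff.comp (contDiff_coord 0)).mul (heightBump.contDiff.comp (contDiff_coord 1))

theorem norm_le_of_cuspCutoff_ne_zero {x : Euc 2} (hx : cuspCutoff x ≠ 0) : ‖x‖ ≤ 4 := by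
  obtain ⟨h0, h1⟩ := mul_ne_zero_iff.1 hx
  have h0' : |x 0| < 2 := by
    by_contra! h
    exact h0 (plateau_eq_zero h)
  have h1' : x 1 ∈ Ioo (1 : ℝ) 3 := by
    by_contra! h
    exact h1 (heightBump_eq_zero h)
  rw [EuclideanSpace.norm_eq, Real.sqrt_le_left (by norm_num), Fin.sum_univ_two, Real.norm_eq_abs,
    Real.norm_eq_abs, sq_abs (x 1)]
  nlinarith [abs_nonneg (x 0), h1'.1, h1'.2]

theorem tsupport_cuspCutoff_subset : tsupport cuspCutoff ⊆ Metric.closedBall 0 4 :=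
  closure_minimal (fun _ hx => mem_closedBall_zero_iff.2 (norm_le_of_cuspCutoff_ne_zero hx))
    Metric.isClosed_closedBall

theorem hasCompactSupport_cuspCutoff : HasCompactSupport cuspCutoff :=
  (isCompact_closedBall _ _).of_isClosed_subset (isClosed_tsupport _) tsupport_cuspCutoff_subset

theorem continuous_heightBump_mul_inv : Continuous fun t : ℝ => heightBump t * t⁻¹ := by
  refine continuous_of_tsupport fun t ht => ?_
  have hsub : tsupport (fun t : ℝ => heightBump t * t⁻¹) ⊆ Icc 1 3 := by
    refine closure_minimal (fun t ht => ?_) isClosed_Icc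
    by_contra h
    refine ht ?_
    simp only
    rw [heightBump_eq_zero fun h' => h (Ioo_subset_Icc_self h'), zero_mul]
  have h1 : t ≠ 0 := by have := (hsub ht).1; positivity
  exact heightBump.continuous.continuousAt.mul (continuousAt_inv₀ h1)

theorem hasCompactSupport_heightBump_mul_inv :
    HasCompactSupport fun t : ℝ => heightBump t * t⁻¹ :=
  heightBump.hasCompactSupport.mul_right

theorem integral_heightBump_mul_inv_pos : 0 < ∫ t : ℝ, heightBump t * t⁻¹ := by
  refine continuous_heightBump_mul_inv.integral_pos_of_hasCompactSupport_nonneg_nonzero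
    hasCompactSupport_heightBump_mul_inv (fun t => ?_) (x := 2) ?_
  · by_cases ht : t ∈ Ioo (1 : ℝ) 3
    · have := ht.1
      exact mul_nonneg heightBump.nonneg (by positivity)
    · simp [heightBump_eq_zero ht]
  · rw [heightBump.one_of_mem_closedBall (by simp [heightBump])]
    norm_num

/-- The flux of the shear flow through the cusp at height comparable to `s`. -/
theorem integral_cusp_flux {w s : ℝ} (hw : 0 < w) (hs : 0 < s) :
    Integrable (fun x : Euc 2 => (w⁻¹ * deriv Real.smoothTransition (w⁻¹ * x 0)) *
      (heightBump (s⁻¹ * x 1) * (x 1)⁻¹)) ∧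
    ∫ x : Euc 2, (w⁻¹ * deriv Real.smoothTransition (w⁻¹ * x 0)) *
      (heightBump (s⁻¹ * x 1) * (x 1)⁻¹) = ∫ t : ℝ, heightBump t * t⁻¹ := by
  -- The integrand is a product of functions of one variable. The first factor has integral `1` for
  -- every `w`; the second has an integral independent of `s` because `dt / t` is invariant under
  -- dilation.
  set k₁ : ℝ → ℝ := fun a => w⁻¹ * deriv Real.smoothTransition (w⁻¹ * a) with hk₁
  set k₂ : ℝ → ℝ := fun b => heightBump (s⁻¹ * b) * b⁻¹ with hk₂
  have hk₂' : k₂ = fun b => s⁻¹ * (heightBump (s⁻¹ * b) * (s⁻¹ * b)⁻¹) := by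
    ext b
    rw [hk₂, mul_inv]
    field_simp
  have hi₁ : Integrable k₁ :=
    (integrable_deriv_smoothTransition.comp_mul_left' (inv_ne_zero hw.ne')).const_mul _
  have hh : Integrable fun t : ℝ => heightBump t * t⁻¹ :=
    continuous_heightBump_mul_inv.integrable_of_hasCompactSupport
      hasCompactSupport_heightBump_mul_inv
  have hi₂ : Integrable k₂ := by
    rw [hk₂']
    exact (hh.comp_mul_left' (inv_ne_zero hs.ne')).const_mul _
  have he₁ : ∫ a, k₁ a = 1 := by
    rw [hk₁, integral_const_mul, Measure.integral_comp_inv_mul_left,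
      integral_deriv_smoothTransition, abs_of_pos hw]
    simp [hw.ne']
  have he₂ : ∫ b, k₂ b = ∫ t : ℝ, heightBump t * t⁻¹ := by
    rw [hk₂', integral_const_mul, Measure.integral_comp_inv_mul_left
      (fun t : ℝ => heightBump t * t⁻¹), abs_of_pos hs, smul_eq_mul, inv_mul_cancel_left₀ hs.ne']
  constructor
  · exact (measurePreserving_coords.integrable_comp_emb measurableEmbedding_coords).2
      (hi₁.mul_prod hi₂)
  · have h1 := measurePreserving_coords.integral_comp measurableEmbedding_coords
      (fun z : ℝ × ℝ => k₁ z.1 * k₂ z.2)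
    rw [h1, Measure.volume_eq_prod, integral_prod_mul k₁ k₂, he₁, he₂, one_mul]

/-- The first term measures the horizontal flux through the cusp, where the extension is known. The
second contains only the gradient of the cutoff and is the error term. -/
theorem fderiv_cusp_test {w s : ℝ} (x v : Euc 2) :
    fderiv ℝ (fun x : Euc 2 => Real.smoothTransition (w⁻¹ * x 0) * cuspCutoff (s⁻¹ • x)) x v
      = (w⁻¹ * deriv Real.smoothTransition (w⁻¹ * x 0)) * cuspCutoff (s⁻¹ • x) * v 0
        + Real.smoothTransition (w⁻¹ * x 0) *
          fderiv ℝ (fun x => cuspCutoff (s⁻¹ • x)) x v := by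
  have hS : HasDerivAt Real.smoothTransition (deriv Real.smoothTransition (w⁻¹ * x 0))
      (w⁻¹ * x 0) :=
    ((Real.smoothTransition.contDiff (n := 1)).differentiable (by simp) _).hasDerivAt
  have h0 : HasFDerivAt (fun x : Euc 2 => w⁻¹ * x 0) _ x :=
    (EuclideanSpace.proj (𝕜 := ℝ) (0 : Fin 2)).hasFDerivAt.const_mul w⁻¹
  have h := hS.comp_hasFDerivAt x h0
  have h1 : HasFDerivAt (fun x : Euc 2 => Real.smoothTransition (w⁻¹ * x 0)) _ x := h
  have h2 : DifferentiableAt ℝ (fun x => cuspCutoff (s⁻¹ • x)) x :=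
    (contDiff_cuspCutoff.comp (contDiff_const_smul s⁻¹)).differentiable (by simp) x
  rw [(h1.fun_mul h2.hasFDerivAt).fderiv]
  simp
  ring

/-- On the support of the derivative `0 ≤ x 0 ≤ w ≤ s`, so the horizontal factor of the cutoff is on
its plateau. -/
theorem cuspCutoff_mul_deriv {w s : ℝ} (hw : 0 < w) (hs : 0 < s) (hws : w ≤ s) (x : Euc 2) :
    (w⁻¹ * deriv Real.smoothTransition (w⁻¹ * x 0)) * cuspCutoff (s⁻¹ • x)
      = (w⁻¹ * deriv Real.smoothTransition (w⁻¹ * x 0)) * heightBump (s⁻¹ * x 1) := by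
  by_cases h : w⁻¹ * x 0 ∈ Icc (0 : ℝ) 1
  · have h0 : 0 ≤ x 0 := by
      have := h.1
      rwa [mul_nonneg_iff_of_pos_left (inv_pos.2 hw)] at this
    have h1 : x 0 ≤ w := by
      have := h.2
      rwa [inv_mul_le_iff₀ hw, mul_one] at this
    have : |s⁻¹ * x 0| ≤ 1 := by
      rw [abs_of_nonneg (by positivity), inv_mul_le_iff₀ hs]
      linarith
    simp [cuspCutoff, plateau_eq_one this]
  · simp [deriv_smoothTransition_eq_zero h]

theorem outwardCusp_not_hasSolenoidalExtension {γ : ℝ} (hγ : 0 < γ) (hγ1 : γ < 1) :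
    ∃ (p : ℝ≥0∞) (_ : Fact (1 ≤ p)), p < ⊤ ∧
      ∀ η : ℝ, 0 < η →
        ¬ HasSolenoidalExtension p (outwardCusp 1 γ)
            (Metric.thickening η (outwardCusp 1 γ)) := by
  have hβ : 1 < γ⁻¹ := (one_lt_inv₀ hγ).2 hγ1
  -- The midpoint of the admissible interval from `2` to `1 + γ⁻¹`.
  set p : ℝ := 2 + (γ⁻¹ - 1) / 2 with hp
  have hp2 : 2 < p := by linarith
  have hp1 : (1 : ℝ) ≤ p := by linarith
  have hp' : 1 ≤ ENNReal.ofReal p := by simpa using hp1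
  have hfact : Fact (1 ≤ ENNReal.ofReal p) := ⟨hp'⟩
  refine ⟨ENNReal.ofReal p, hfact, ENNReal.ofReal_lt_top, fun η hη hext => ?_⟩
  set Ω : Set (Euc 2) := outwardCusp 1 γ with hΩdef
  have hΩ : IsOpen Ω := isOpen_outwardCusp hγ 1
  set Ω' : Set (Euc 2) := Metric.thickening η Ω with hΩ'
  obtain ⟨v, hv, hvd, hvu⟩ := HasSolenoidalExtension.exists_extension (n := 2) hext
    (memLp_shearFlow hγ (by linarith) (by linarith))
    (divFree_shearFlow.mono fun x hx => ((mem_outwardCusp_one hγ).1 hx).2.1)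
  obtain ⟨C, hC⟩ := (hasCompactSupport_cuspCutoff.fderiv (𝕜 := ℝ)).exists_bound_of_continuous
    (contDiff_cuspCutoff.continuous_fderiv (by simp))
  have hC0 : 0 ≤ C := (norm_nonneg _).trans (hC 0)
  set c := ∫ t : ℝ, heightBump t * t⁻¹ with hc
  have hcpos : 0 < c := integral_heightBump_mul_inv_pos
  set N := (eLpNorm v (ENNReal.ofReal p) (volume.restrict Ω')).toReal with hN
  set V := volume.real (Metric.ball (0 : Euc 2) 1) with hV
  have hbound : ∀ s : ℝ, 0 < s → s < 1 / 3 → 5 * s < η →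
      c ≤ C * N * ((5 ^ 2 * V) ^ (1 - 1 / p)) * s ^ (1 - 2 / p) := by
    intro s hs hs1 hsη
    -- The half-width of the cusp at height `s`: the transition layer `0 ≤ x 0 ≤ w` fits inside the
    -- cusp at all heights above `s`.
    set w : ℝ := s ^ γ⁻¹ with hwdef
    have hw : 0 < w := by positivity
    have hws : w ≤ s := by
      calc w ≤ s ^ (1 : ℝ) := Real.rpow_le_rpow_of_exponent_ge hs (by linarith) hβ.le
        _ = s := Real.rpow_one s
    set ρ : Euc 2 → ℝ := fun x => cuspCutoff (s⁻¹ • x) with hρ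
    have hρ1 : ContDiff ℝ ∞ ρ := contDiff_cuspCutoff.comp (contDiff_const_smul _)
    have hρ2 : HasCompactSupport ρ := hasCompactSupport_cuspCutoff.comp_smul (inv_ne_zero hs.ne')
    have hball : tsupport ρ ⊆ Metric.ball 0 (5 * s) := by
      refine (closure_minimal (t := Metric.closedBall 0 (4 * s)) (fun x hx => ?_)
        Metric.isClosed_closedBall).trans (Metric.closedBall_subset_ball (by linarith))
      have := norm_le_of_cuspCutoff_ne_zero hx
      rw [norm_smul, norm_inv, Real.norm_of_nonneg hs.le, inv_mul_le_iff₀ hs] at this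
      rw [mem_closedBall_zero_iff]
      linarith
    have hballΩ' : Metric.ball (0 : Euc 2) (5 * s) ⊆ Ω' :=
      (Metric.ball_subset_ball hsη.le).trans
        (ball_subset_thickening_of_mem_closure (zero_mem_closure_outwardCusp_one hγ) η)
    set φ : Euc 2 → ℝ := fun x => Real.smoothTransition (w⁻¹ * x 0) * ρ x with hφ
    have hφ1 : ContDiff ℝ ∞ φ :=
      (Real.smoothTransition.contDiff.comp (contDiff_const.mul (contDiff_coord 0))).mul hρ1
    have hφ2 : HasCompactSupport φ := hρ2.mul_left
    have hφ3 : tsupport φ ⊆ Ω' :=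
      (tsupport_mul_subset_right.trans hball).trans hballΩ'
    have hzero := hvd φ hφ1 hφ2 hφ3
    obtain ⟨hKi, hKe⟩ := integral_cusp_flux hw hs
    set K : Euc 2 → ℝ := fun x => (w⁻¹ * deriv Real.smoothTransition (w⁻¹ * x 0)) *
      (heightBump (s⁻¹ * x 1) * (x 1)⁻¹) with hK
    -- The kernel lives on `0 ≤ x 0 ≤ w`, `s < x 1 < 3s`. There `x 0 ≤ s^(1/γ) < (x 1)^(1/γ)`, and
    -- `s < 1/3` keeps the height below `1`.
    have hstrip : ∀ x : Euc 2, x ∉ Ω →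
        (w⁻¹ * deriv Real.smoothTransition (w⁻¹ * x 0)) * heightBump (s⁻¹ * x 1) = 0 := by
      intro x hx
      by_cases h : w⁻¹ * x 0 ∈ Icc (0 : ℝ) 1
      · by_cases h' : s⁻¹ * x 1 ∈ Ioo (1 : ℝ) 3
        · refine absurd ((mem_outwardCusp_one hγ).2 ?_) hx
          have h0 : 0 ≤ x 0 := by
            have := h.1
            rwa [mul_nonneg_iff_of_pos_left (inv_pos.2 hw)] at this
          have h1 : x 0 ≤ w := by
            have := h.2
            rwa [inv_mul_le_iff₀ hw, mul_one] at this
          have h2 : s < x 1 := by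
            have := h'.1
            rwa [lt_inv_mul_iff₀ hs, mul_one] at this
          have h3 : x 1 < s * 3 := by
            have := h'.2
            rwa [inv_mul_lt_iff₀ hs] at this
          rw [abs_of_nonneg h0]
          refine ⟨by linarith, by linarith, by linarith, h1.trans_lt ?_⟩
          exact Real.rpow_lt_rpow hs.le h2 (by positivity)
        · rw [heightBump_eq_zero h', mul_zero]
      · rw [deriv_smoothTransition_eq_zero h]
        ring
    have hKae : (fun x => (w⁻¹ * deriv Real.smoothTransition (w⁻¹ * x 0)) * ρ x * v x 0)
        =ᵐ[volume.restrict Ω'] K := by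
      have hv0 : ∀ᵐ x, x ∈ Ω → v x = shearFlow x := by
        rw [← ae_restrict_iff' hΩ.measurableSet]
        exact hvu
      filter_upwards [ae_restrict_of_ae hv0] with x hx
      rw [hρ, hK]
      simp only
      rw [cuspCutoff_mul_deriv hw hs hws, ← mul_assoc]
      by_cases hxΩ : x ∈ Ω
      · rw [hx hxΩ]
        simp [shearFlow]
      · rw [hstrip x hxΩ, zero_mul, zero_mul]
    have hKΩ' : ∫ x in Ω', K x = c := by
      refine (setIntegral_eq_integral_of_forall_compl_eq_zero fun x hx => ?_).trans hKe
      rw [hK]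
      simp only
      rw [← mul_assoc, hstrip x fun h => hx (Metric.self_subset_thickening hη _ h), zero_mul]
    have hA : Integrable (fun x => (w⁻¹ * deriv Real.smoothTransition (w⁻¹ * x 0)) * ρ x * v x 0)
        (volume.restrict Ω') := (integrable_congr hKae).2 hKi.restrict
    have hrest : ∫ x in Ω', Real.smoothTransition (w⁻¹ * x 0) * fderiv ℝ ρ x (v x) = -c := by
      have h1 := integral_sub (integrable_fderiv_apply hp' hv hφ1 hφ2) hA
      rw [hzero, integral_congr_ae hKae, hKΩ', zero_sub] at h1
      rw [← h1]
      refine integral_congr_ae (.of_forall fun x => ?_)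
      simp only [hφ, hρ, fderiv_cusp_test]
      ring
    have hpt : ∀ᵐ x ∂volume.restrict Ω',
        ‖Real.smoothTransition (w⁻¹ * x 0) * fderiv ℝ ρ x (v x)‖ ≤
        (Metric.ball (0 : Euc 2) (5 * s)).indicator (fun x => C * s⁻¹ * ‖v x‖) x := by
      refine .of_forall fun x => ?_
      by_cases hx : x ∈ Metric.ball (0 : Euc 2) (5 * s)
      · rw [indicator_of_mem hx, norm_mul, Real.norm_of_nonneg (Real.smoothTransition.nonneg _)]
        calc _ ≤ 1 * ‖fderiv ℝ ρ x (v x)‖ := by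
              gcongr
              exact Real.smoothTransition.le_one _
          _ ≤ ‖fderiv ℝ ρ x‖ * ‖v x‖ := by
              rw [one_mul]
              exact (fderiv ℝ ρ x).le_opNorm _
          _ ≤ C * s⁻¹ * ‖v x‖ := by
              gcongr
              rw [hρ, fderiv_comp_smul, norm_smul, norm_inv, Real.norm_of_nonneg hs.le, mul_comm]
              gcongr
              exact hC _
      · rw [indicator_of_notMem hx, image_eq_zero_of_notMem_tsupport (f := fderiv ℝ ρ)
          fun h => hx (hball (tsupport_fderiv_subset ℝ h))]
        simp
    have hfin := norm_setIntegral_le_mul_eLpNorm_mul_volume_rpow hp1 hv measurableSet_ball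
      measure_ball_lt_top.ne (mul_nonneg hC0 (inv_nonneg.2 hs.le)) hpt
    rw [hrest, norm_neg, Real.norm_of_nonneg hcpos.le] at hfin
    refine hfin.trans_eq ?_
    have hvol : volume.real (Metric.ball (0 : Euc 2) (5 * s)) = 5 ^ 2 * V * s ^ (2 : ℝ) := by
      rw [Measure.real, Measure.addHaar_ball volume 0 (by positivity), ENNReal.toReal_mul,
        ENNReal.toReal_ofReal (by positivity), finrank_euclideanSpace, Fintype.card_fin,
        Real.rpow_two, hV, Measure.real]
      ring
    have hV0 : 0 ≤ V := measureReal_nonneg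
    -- The area of the ball contributes `s^(2(1 - 1/p))` and the gradient of the cutoff `s⁻¹`.
    have hexp : s ^ (1 - 2 / p) = s ^ (2 * (1 - 1 / p)) * s⁻¹ := by
      rw [← div_eq_mul_inv, ← Real.rpow_sub_one hs.ne']
      congr 1
      ring
    rw [hvol, Real.mul_rpow (by positivity) (by positivity), ← Real.rpow_mul hs.le, hexp]
    ring
  have he0 : 0 < 1 - 2 / p := by
    rw [sub_pos, div_lt_one (by linarith)]; exact hp2
  have hlim : Filter.Tendsto (fun s : ℝ => C * N * ((5 ^ 2 * V) ^ (1 - 1 / p)) * s ^ (1 - 2 / p))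
      (nhdsWithin 0 (Ioi 0)) (nhds 0) := by
    have : ContinuousAt
        (fun s : ℝ => C * N * ((5 ^ 2 * V) ^ (1 - 1 / p)) * s ^ (1 - 2 / p)) 0 :=
      (Real.continuousAt_rpow_const 0 _ (Or.inr he0.le)).const_mul _
    have h := this.tendsto.mono_left (nhdsWithin_le_nhds (s := Ioi 0))
    simpa [Real.zero_rpow he0.ne'] using h
  refine absurd hcpos (not_lt.2 (ge_of_tendsto hlim ?_))
  filter_upwards [self_mem_nhdsWithin,
    mem_nhdsWithin_of_mem_nhds (Iio_mem_nhds (show (0 : ℝ) < min (1 / 3) (η / 5) by positivity))]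
    with s hs hs'
  have := lt_min_iff.1 (mem_Iio.1 hs')
  exact hbound s hs this.1 (by linarith [this.2])

/-! ### Arcs on spheres and a Lipschitz-curve criterion for `(ε, δ)`-domains -/

/-- In dimension at least two, every unit vector has a unit normal. -/
theorem exists_norm_eq_one_inner_eq_zero {E : Type*} [NormedAddCommGroup E]
    [InnerProductSpace ℝ E] [FiniteDimensional ℝ E] (hE : 2 ≤ Module.finrank ℝ E) (u : E) :
    ∃ e : E, ‖e‖ = 1 ∧ ⟪u, e⟫ = 0 := by
  have h1 : Module.finrank ℝ (ℝ ∙ u) ≤ 1 := by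
    simpa using finrank_span_le_card (R := ℝ) ({u} : Set E)
  have h2 := Submodule.finrank_add_finrank_orthogonal (ℝ ∙ u)
  have : Nontrivial (ℝ ∙ u)ᗮ := Module.nontrivial_of_finrank_pos (R := ℝ) (by omega)
  obtain ⟨e, he⟩ := exists_norm_eq (ℝ ∙ u)ᗮ (zero_le_one (α := ℝ))
  exact ⟨e, by simpa using he, Submodule.mem_orthogonal_singleton_iff_inner_right.1 e.2⟩

/-- Two unit vectors are joined by an arc in the unit sphere whose speed is comparable to their
distance. -/
theorem exists_lipschitz_arc {E : Type*} [NormedAddCommGroup E]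
    [InnerProductSpace ℝ E] [FiniteDimensional ℝ E] (hE : 2 ≤ Module.finrank ℝ E) {u v : E}
    (hu : ‖u‖ = 1) (hv : ‖v‖ = 1) :
    ∃ σ : ℝ → E, σ 0 = u ∧ σ 1 = v ∧ (∀ t, ‖σ t‖ = 1) ∧
      ∀ s t, ‖σ s - σ t‖ ≤ 2 * ‖u - v‖ * |s - t| := by
  set k := ⟪u, v⟫ with hk
  have hk1 : |k| ≤ 1 := by
    have := abs_real_inner_le_norm u v
    rwa [hu, hv, mul_one] at this
  have huu : ⟪u, u⟫ = 1 := by rw [real_inner_self_eq_norm_sq, hu, one_pow]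
  have hvv : ⟪v, v⟫ = 1 := by rw [real_inner_self_eq_norm_sq, hv, one_pow]
  -- Gram–Schmidt in the plane of `u` and `v`. If `v = ±u` that plane is undetermined and any unit
  -- normal will do; this is where the dimension enters.
  have hexp : ∃ e : E, ‖e‖ = 1 ∧ ⟪u, e⟫ = 0 ∧ v = k • u + √(1 - k ^ 2) • e := by
    set w := v - k • u with hw
    have huw : ⟪u, w⟫ = 0 := by
      rw [hw, inner_sub_right, inner_smul_right, huu, ← hk]
      ring
    have hww : ‖w‖ ^ 2 = 1 - k ^ 2 := by
      rw [← real_inner_self_eq_norm_sq, hw, inner_sub_left, inner_sub_right, inner_sub_right,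
        inner_smul_left, inner_smul_right, inner_smul_left, inner_smul_right, huu, hvv,
        real_inner_comm, ← hk]
      simp
      ring
    have hwn : √(1 - k ^ 2) = ‖w‖ := by rw [← hww, Real.sqrt_sq (norm_nonneg _)]
    by_cases h0 : w = 0
    · obtain ⟨e, he, hue⟩ := exists_norm_eq_one_inner_eq_zero hE u
      refine ⟨e, he, hue, ?_⟩
      rw [hwn, h0, norm_zero, zero_smul, add_zero]
      exact sub_eq_zero.1 h0
    · refine ⟨‖w‖⁻¹ • w, ?_, ?_, ?_⟩
      · exact norm_smul_inv_norm h0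
      · rw [inner_smul_right, huw, mul_zero]
      · rw [hwn, smul_inv_smul₀ (norm_ne_zero_iff.2 h0), hw]
        abel
  obtain ⟨e, he, hue, hve⟩ := hexp
  have hee : ⟪e, e⟫ = 1 := by rw [real_inner_self_eq_norm_sq, he, one_pow]
  have hnorm : ∀ a b : ℝ, ‖a • u + b • e‖ ^ 2 = a ^ 2 + b ^ 2 := by
    intro a b
    rw [← real_inner_self_eq_norm_sq]
    simp only [inner_add_left, inner_add_right, inner_smul_left, inner_smul_right, huu, hee, hue,
      real_inner_comm]
    simp
    ring
  set θ := Real.arccos k with hθ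
  have hcos : Real.cos θ = k := Real.cos_arccos (abs_le.1 hk1).1 (abs_le.1 hk1).2
  have hsin : Real.sin θ = √(1 - k ^ 2) := Real.sin_arccos k
  have hdist : ∀ a b : ℝ, ‖(Real.cos a • u + Real.sin a • e) -
      (Real.cos b • u + Real.sin b • e)‖ ^ 2 = 2 - 2 * Real.cos (a - b) := by
    intro a b
    have : (Real.cos a • u + Real.sin a • e) - (Real.cos b • u + Real.sin b • e)
        = (Real.cos a - Real.cos b) • u + (Real.sin a - Real.sin b) • e := by
      module
    rw [this, hnorm, Real.cos_sub]
    nlinarith [Real.sin_sq_add_cos_sq a, Real.sin_sq_add_cos_sq b]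
  have hθ0 : 0 ≤ θ := Real.arccos_nonneg k
  -- The chord satisfies `‖u - v‖² = 2 - 2 cos θ ≥ 4θ²/π²`, and `π < 4` turns this into the factor
  -- `2`.
  have hθle : θ ≤ 2 * ‖u - v‖ := by
    have h1 := hdist 0 θ
    rw [Real.cos_zero, Real.sin_zero, one_smul, zero_smul, add_zero, hcos, hsin, ← hve, zero_sub,
      Real.cos_neg] at h1
    have h2 : Real.cos θ ≤ 1 - 2 / Real.pi ^ 2 * θ ^ 2 :=
      Real.cos_le_one_sub_mul_cos_sq (by rw [abs_of_nonneg hθ0]; exact Real.arccos_le_pi k)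
    have h3 : (1 : ℝ) / 8 ≤ 2 / Real.pi ^ 2 := by
      rw [div_le_div_iff₀ (by norm_num) (by positivity)]
      nlinarith [Real.pi_lt_four, Real.pi_pos]
    have h4 : θ ^ 2 ≤ (2 * ‖u - v‖) ^ 2 := by
      rw [mul_pow, h1]
      nlinarith [mul_le_mul_of_nonneg_right h3 (sq_nonneg θ)]
    exact abs_le_of_sq_le_sq' h4 (by positivity) |>.2
  refine ⟨fun t => Real.cos (t * θ) • u + Real.sin (t * θ) • e, by simp, ?_, fun t => ?_,
    fun s t => ?_⟩
  · simp only [one_mul]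
    rw [hcos, hsin, ← hve]
  · have := hnorm (Real.cos (t * θ)) (Real.sin (t * θ))
    rw [Real.cos_sq_add_sin_sq] at this
    exact (pow_eq_one_iff_of_nonneg (norm_nonneg _) two_ne_zero).1 this
  · have h1 : ‖(Real.cos (s * θ) • u + Real.sin (s * θ) • e) -
        (Real.cos (t * θ) • u + Real.sin (t * θ) • e)‖ ^ 2 ≤ (|s - t| * θ) ^ 2 := by
      rw [hdist]
      have := Real.one_sub_sq_div_two_le_cos (x := s * θ - t * θ)
      rw [mul_pow, sq_abs, ← mul_pow]
      nlinarith
    have h2 := abs_le_of_sq_le_sq' h1 (by positivity) |>.2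
    refine h2.trans ?_
    rw [mul_comm]
    gcongr

theorem le_infEDist_frontier_of_ball_subset {X : Type*} [PseudoMetricSpace X] {Ω : Set X}
    (hΩ : IsOpen Ω) {x : X} {r : ℝ} (h : Metric.ball x r ⊆ Ω) :
    ENNReal.ofReal r ≤ Metric.infEDist x (frontier Ω) := by
  refine Metric.le_infEDist.2 fun y hy => ?_
  by_contra! hlt
  have hyΩ : y ∈ Ω := h (by rwa [Metric.mem_ball', ← edist_lt_ofReal])
  rw [hΩ.frontier_eq] at hy
  exact hy.2 hyΩ

/-- A domain is an `(ε, δ)`-domain if nearby points are joined by curves with controlled Lipschitz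
constant whose distance to the boundary grows linearly away from the end points. -/
theorem isEpsDeltaDomain_of_lipschitz_curves {n : ℕ} {Ω : Set (Euc n)} (hΩ : IsOpen Ω)
    {L κ δ : ℝ} (hL : 1 ≤ L) (hκ : 0 < κ) (hκ1 : κ ≤ 1) (hδ : 0 < δ)
    (h : ∀ x ∈ Ω, ∀ y ∈ Ω, x ≠ y → dist x y < δ → ∃ c : ℝ → Euc n, c 0 = x ∧ c 1 = y ∧
      (∀ s ∈ Icc (0 : ℝ) 1, ∀ t ∈ Icc (0 : ℝ) 1, dist (c s) (c t) ≤ L * dist x y * |s - t|) ∧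
      ∀ t ∈ Ioo (0 : ℝ) 1, Metric.ball (c t) (κ * (dist x y * (t * (1 - t)))) ⊆ Ω) :
    IsEpsDeltaDomain (κ / (2 * L ^ 2)) (ENNReal.ofReal δ) Ω := by
  have hL0 : 0 < L := by linarith
  -- With `d = dist x y`, the length is at most `L d`, and the product of the distances from `c t`
  -- to the end points is at most `L² d² t(1 - t)`. The factor `2` in `ε` makes both required
  -- inequalities strict.
  refine ⟨by positivity, by simpa using hδ, hΩ, fun x hx y hy hxy hlt => ?_⟩
  have hd : 0 < dist x y := dist_pos.2 hxy
  rw [edist_lt_ofReal] at hlt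
  obtain ⟨c, h0, h1, hlip, hball⟩ := h x hx y hy hxy hlt
  have hLd : 0 ≤ L * dist x y := by positivity
  have hlip' : LipschitzOnWith ⟨L * dist x y, hLd⟩ c (Icc 0 1) :=
    LipschitzOnWith.of_dist_le_mul fun s hs t ht => hlip s hs t ht
  have hmem : ∀ t : unitInterval, c t ∈ Ω := by
    intro t
    rcases eq_or_lt_of_le t.2.1 with ht0 | ht0
    · rw [← ht0, h0]; exact hx
    rcases eq_or_lt_of_le t.2.2 with ht1 | ht1
    · rw [ht1, h1]; exact hy
    refine hball t ⟨ht0, ht1⟩ (Metric.mem_ball_self ?_)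
    have := sub_pos.2 ht1
    positivity
  have hpos : ∀ z ∈ Ω, 0 < Metric.infEDist z (frontier Ω) := by
    intro z hz
    obtain ⟨r, hr, hrΩ⟩ := Metric.isOpen_iff.1 hΩ z hz
    exact (ENNReal.ofReal_pos.2 hr).trans_le (le_infEDist_frontier_of_ball_subset hΩ hrΩ)
  refine ⟨⟨⟨fun t : unitInterval => c t, hlip'.continuousOn.domRestrict⟩, by simpa using h0,
    by simpa using h1⟩, hmem, ?_, fun t => ?_⟩
  · calc eVariationOn (fun t : unitInterval => c t) univ
        ≤ ENNReal.ofReal (L * dist x y) * eVariationOn (Subtype.val : unitInterval → ℝ) univ := by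
          have := hlip'.comp_eVariationOn_le (g := (Subtype.val : unitInterval → ℝ)) (s := univ)
            fun t _ => t.2
          refine this.trans_eq ?_
          rw [ENNReal.ofReal, Real.toNNReal_of_nonneg hLd]
          rfl
      _ ≤ ENNReal.ofReal (L * dist x y) * 1 := by
          gcongr
          have := MonotoneOn.eVariationOn_eq (f := (Subtype.val : unitInterval → ℝ)) (s := univ)
            (fun _ _ _ _ h => h) (mem_univ (0 : unitInterval)) (mem_univ (1 : unitInterval))
          refine (eVariationOn.mono _ ?_).trans (this.le.trans (by simp))
          intro t _
          exact ⟨mem_univ _, t.2.1, t.2.2⟩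
      _ < ENNReal.ofReal (dist x y / (κ / (2 * L ^ 2))) := by
          rw [mul_one, ENNReal.ofReal_lt_ofReal_iff (by positivity), lt_div_iff₀ (by positivity),
            show L * dist x y * (κ / (2 * L ^ 2)) = dist x y * (κ / (2 * L)) by field_simp]
          refine mul_lt_of_lt_one_right hd ?_
          rw [div_lt_one (by positivity)]
          linarith
  · change ENNReal.ofReal (κ / (2 * L ^ 2) * (dist x (c t) * dist y (c t))) <
      Metric.infEDist (c t) (frontier Ω) * edist x y
    have hed : edist x y = ENNReal.ofReal (dist x y) := edist_dist x y
    by_cases ht : (t : ℝ) ∈ Ioo (0 : ℝ) 1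
    · have ht0 := ht.1
      have ht1 := sub_pos.2 ht.2
      have hx1 : dist x (c t) ≤ L * dist x y * t := by
        have := hlip 0 (by simp) t t.2
        rwa [h0, zero_sub, abs_neg, abs_of_pos ht0] at this
      have hy1 : dist y (c t) ≤ L * dist x y * (1 - t) := by
        have := hlip 1 (by simp) t t.2
        rwa [h1, abs_of_pos ht1] at this
      calc ENNReal.ofReal (κ / (2 * L ^ 2) * (dist x (c t) * dist y (c t)))
          ≤ ENNReal.ofReal (κ / (2 * L ^ 2) * ((L * dist x y * t) * (L * dist x y * (1 - t)))) := by
            gcongr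
        _ < ENNReal.ofReal (κ * (dist x y * (t * (1 - t))) * dist x y) := by
            rw [ENNReal.ofReal_lt_ofReal_iff (by positivity),
              show κ / (2 * L ^ 2) * ((L * dist x y * t) * (L * dist x y * (1 - t)))
                = (κ * (dist x y * (t * (1 - t))) * dist x y) / 2 by field_simp]
            refine half_lt_self (by positivity)
        _ = ENNReal.ofReal (κ * (dist x y * (t * (1 - t)))) * edist x y := by
            rw [hed, ENNReal.ofReal_mul (by positivity)]
        _ ≤ _ := by
            gcongr
            exact le_infEDist_frontier_of_ball_subset hΩ (hball t ht)
    -- At the end points the left side is zero, and strictness comes from the positive distance of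
    -- points of an open set to its frontier.
    · have hz : dist x (c t) * dist y (c t) = 0 := by
        rcases eq_or_lt_of_le t.2.1 with ht0 | ht0
        · rw [← ht0, h0, dist_self, zero_mul]
        rcases eq_or_lt_of_le t.2.2 with ht1 | ht1
        · rw [ht1, h1, dist_self, mul_zero]
        exact absurd ⟨ht0, ht1⟩ ht
      rw [hz, mul_zero, ENNReal.ofReal_zero]
      exact ENNReal.mul_pos (hpos _ (hmem t)).ne' (by rw [hed]; simpa using hxy)

/-! ### The complement of a quadratic spike is an `(ε, δ)`-domain -/

/-- The point `(x', y)` of `ℝ^m × ℝ = ℝ^{m+1}`. -/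
def snocEuc {m : ℕ} (x : Euc m) (y : ℝ) : Euc (m + 1) :=
  WithLp.toLp 2 (Fin.snoc (α := fun _ => ℝ) (fun i => x i) y)

@[simp] theorem snocEuc_castSucc {m : ℕ} (x : Euc m) (y : ℝ) (i : Fin m) :
    snocEuc x y i.castSucc = x i := by
  simp [snocEuc]

@[simp] theorem snocEuc_last {m : ℕ} (x : Euc m) (y : ℝ) : snocEuc x y (Fin.last m) = y := by
  simp [snocEuc]

@[simp] theorem horizontal_apply {m : ℕ} (x : Euc (m + 1)) (i : Fin m) :
    horizontal x i = x i.castSucc := rfl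

@[simp] theorem horizontal_snocEuc {m : ℕ} (x : Euc m) (y : ℝ) :
    horizontal (snocEuc x y) = x := by
  ext i
  simp

@[simp] theorem snocEuc_horizontal {m : ℕ} (x : Euc (m + 1)) :
    snocEuc (horizontal x) (x (Fin.last m)) = x := by
  ext i
  refine Fin.lastCases ?_ (fun j => ?_) i <;> simp

theorem norm_le_norm_horizontal_add {m : ℕ} (x : Euc (m + 1)) :
    ‖x‖ ≤ ‖horizontal x‖ + |x (Fin.last m)| := by
  have h : ‖x‖ ^ 2 = ‖horizontal x‖ ^ 2 + |x (Fin.last m)| ^ 2 := by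
    rw [EuclideanSpace.real_norm_sq_eq, EuclideanSpace.real_norm_sq_eq, Fin.sum_univ_castSucc,
      sq_abs]
    simp
  refine abs_le_of_sq_le_sq' ?_ (by positivity) |>.2
  rw [h]
  nlinarith [mul_nonneg (norm_nonneg (horizontal x)) (abs_nonneg (x (Fin.last m)))]

theorem norm_horizontal_le {m : ℕ} (x : Euc (m + 1)) : ‖horizontal x‖ ≤ ‖x‖ := by
  refine abs_le_of_sq_le_sq' ?_ (norm_nonneg _) |>.2
  rw [EuclideanSpace.real_norm_sq_eq, EuclideanSpace.real_norm_sq_eq, Fin.sum_univ_castSucc]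
  simp [sq_nonneg]

theorem horizontal_sub {m : ℕ} (x y : Euc (m + 1)) :
    horizontal (x - y) = horizontal x - horizontal y := rfl

theorem horizontal_smul {m : ℕ} (a : ℝ) (x : Euc (m + 1)) :
    horizontal (a • x) = a • horizontal x := rfl

/-- For `γ = 1/2` the spike is described by the convex function `max y 0 ^ 2` of the height. The
inequality cannot be strict: the domain contains the axis below the tip, where both sides vanish. -/
theorem max_sq_le_of_mem_inwardCusp {m : ℕ} {x : Euc (m + 1)} (hx : x ∈ inwardCusp m (1 / 2)) :
    max (x (Fin.last m)) 0 ^ 2 ≤ ‖horizontal x‖ := by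
  have h := hx.2
  rw [cuspProfile_of_nonneg (by norm_num) (norm_nonneg _), ← Real.sqrt_eq_rpow] at h
  have : max (x (Fin.last m)) 0 ≤ √‖horizontal x‖ := max_le h.le (Real.sqrt_nonneg _)
  exact (Real.le_sqrt (le_max_right _ _) (norm_nonneg _)).1 this

theorem mem_inwardCusp_of_max_sq_lt {m : ℕ} {x : Euc (m + 1)} (hx : ∀ i, |x i| < 1)
    (h : max (x (Fin.last m)) 0 ^ 2 < ‖horizontal x‖) : x ∈ inwardCusp m (1 / 2) := by
  refine ⟨fun i => abs_lt.1 (hx i), ?_⟩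
  rw [cuspProfile_of_nonneg (by norm_num) (norm_nonneg _), ← Real.sqrt_eq_rpow]
  exact (le_max_left _ _).trans_lt ((Real.lt_sqrt (le_max_right _ _)).2 h)

/-- On `y ≤ 1` the function `max y 0 ^ 2` is 2-Lipschitz and `‖horizontal x‖` is 1-Lipschitz, so a
move shorter than `t / 3` uses up less than the margin `t`. -/
theorem ball_subset_inwardCusp {m : ℕ} {x : Euc (m + 1)} {t : ℝ} (ht : 0 < t)
    (hx : ∀ i, |x i| ≤ 1 - t) (h : max (x (Fin.last m)) 0 ^ 2 + t ≤ ‖horizontal x‖) :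
    Metric.ball x (t / 3) ⊆ inwardCusp m (1 / 2) := by
  intro z hz
  rw [Metric.mem_ball, dist_eq_norm] at hz
  have hi : ∀ i, |z i - x i| ≤ ‖z - x‖ := fun i => PiLp.norm_apply_le (z - x) i
  have hz1 : ∀ i, |z i| < 1 := fun i => by
    have h1 : |z i| ≤ |x i| + |z i - x i| := by
      simpa using abs_add_le (x i) (z i - x i)
    linarith [hx i, hi i]
  refine mem_inwardCusp_of_max_sq_lt hz1 ?_
  have h1 : ‖horizontal x‖ ≤ ‖horizontal z‖ + ‖z - x‖ := by
    have h2 : ‖horizontal x‖ ≤ ‖horizontal z‖ + ‖horizontal z - horizontal x‖ :=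
      norm_le_norm_add_norm_sub _ _
    rw [← horizontal_sub] at h2
    linarith [norm_horizontal_le (z - x)]
  have h3 : max (z (Fin.last m)) 0 ≤ max (x (Fin.last m)) 0 + ‖z - x‖ := by
    refine max_le ?_ (by positivity)
    linarith [le_abs_self (z (Fin.last m) - x (Fin.last m)), hi (Fin.last m),
      le_max_left (x (Fin.last m)) 0]
  have h4 : max (z (Fin.last m)) 0 ≤ 1 :=
    max_le ((le_abs_self _).trans (hz1 _).le) zero_le_one
  have h5 : max (x (Fin.last m)) 0 ≤ 1 :=
    max_le ((le_abs_self _).trans ((hx _).trans (by linarith))) zero_le_one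
  have h6 : 0 ≤ max (z (Fin.last m)) 0 := le_max_right _ _
  have h7 : 0 ≤ max (x (Fin.last m)) 0 := le_max_right _ _
  set M := max (z (Fin.last m)) 0
  set X := max (x (Fin.last m)) 0
  have h8 : M ^ 2 ≤ X ^ 2 + 2 * ‖z - x‖ := by
    nlinarith [norm_nonneg (z - x),
      mul_le_mul_of_nonneg_left (show M + X ≤ 2 by linarith) (norm_nonneg (z - x)),
      mul_le_mul_of_nonneg_right (show M - X ≤ ‖z - x‖ by linarith) (show 0 ≤ M + X by linarith)]
  linarith

/-- Unit directions of two vectors, quantitatively. -/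
theorem exists_unit_directions {E : Type*} [NormedAddCommGroup E] [NormedSpace ℝ E]
    [Nontrivial E] (a b : E) :
    ∃ u v : E, ‖u‖ = 1 ∧ ‖v‖ = 1 ∧ a = ‖a‖ • u ∧ b = ‖b‖ • v ∧
      ‖a‖ * ‖u - v‖ ≤ 2 * ‖a - b‖ ∧ ‖b‖ * ‖u - v‖ ≤ 2 * ‖a - b‖ := by
  have hdir : ∀ a : E, ∃ u : E, ‖u‖ = 1 ∧ a = ‖a‖ • u := by
    intro a
    by_cases ha : a = 0
    · obtain ⟨e, he⟩ := exists_norm_eq E (zero_le_one (α := ℝ))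
      exact ⟨e, he, by simp [ha]⟩
    · exact ⟨‖a‖⁻¹ • a, norm_smul_inv_norm ha, by
        rw [smul_inv_smul₀ (norm_ne_zero_iff.2 ha)]⟩
  have hest : ∀ a b u v : E, ‖v‖ = 1 → a = ‖a‖ • u → b = ‖b‖ • v →
      ‖a‖ * ‖u - v‖ ≤ 2 * ‖a - b‖ := by
    intro a b u v hv ha hb
    -- Since `a - b = ‖a‖(u - v) + (‖a‖ - ‖b‖)v`, both errors are at most `‖a - b‖`.
    calc ‖a‖ * ‖u - v‖ = ‖‖a‖ • (u - v)‖ := by rw [norm_smul, norm_norm]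
      _ = ‖(a - b) + (‖b‖ - ‖a‖) • v‖ := by
          congr 1
          rw [smul_sub, sub_smul, ← ha, ← hb]
          abel
      _ ≤ ‖a - b‖ + ‖(‖b‖ - ‖a‖) • v‖ := norm_add_le _ _
      _ ≤ ‖a - b‖ + ‖a - b‖ := by
          gcongr
          rw [norm_smul, hv, mul_one, Real.norm_eq_abs, norm_sub_rev]
          exact abs_norm_sub_norm_le b a
      _ = 2 * ‖a - b‖ := by ring
  obtain ⟨u, hu, ha⟩ := hdir a
  obtain ⟨v, hv, hb⟩ := hdir b
  refine ⟨u, v, hu, hv, ha, hb, hest a b u v hv ha hb, ?_⟩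
  rw [norm_sub_rev u, norm_sub_rev a]
  exact hest b a v u hu hb ha

/-- Two points outside the spike `|x'| ≤ y²` are joined by a Lipschitz curve which moves away from
the spike. -/
theorem exists_lipschitz_curve_avoiding_spike {m : ℕ} (hm : 2 ≤ m) {a b : Euc (m + 1)}
    (hP : max (a (Fin.last m)) 0 ^ 2 ≤ ‖horizontal a‖)
    (hQ : max (b (Fin.last m)) 0 ^ 2 ≤ ‖horizontal b‖) :
    ∃ z : ℝ → Euc (m + 1), z 0 = a ∧ z 1 = b ∧
      (∀ s ∈ Icc (0 : ℝ) 1, ∀ t ∈ Icc (0 : ℝ) 1, ‖z s - z t‖ ≤ 9 * dist a b * |s - t|) ∧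
      ∀ t ∈ Icc (0 : ℝ) 1, max (z t (Fin.last m)) 0 ^ 2 + dist a b * (t * (1 - t)) ≤
        ‖horizontal (z t)‖ := by
  have hE : 2 ≤ Module.finrank ℝ (Euc m) := by simpa using hm
  have hnt : Nontrivial (Euc m) := Module.nontrivial_of_finrank_pos (R := ℝ) (by omega)
  set d := dist a b
  have hd0 : 0 ≤ d := dist_nonneg
  have hdn : ‖a - b‖ = d := (dist_eq_norm a b).symm
  have hdh : ‖horizontal a - horizontal b‖ ≤ d := by
    rw [← horizontal_sub, ← hdn]
    exact norm_horizontal_le _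
  obtain ⟨u, v, hu, hv, hau, hbv, h1, h2⟩ := exists_unit_directions (horizontal a) (horizontal b)
  obtain ⟨σ, hσ0, hσ1, hσn, hσl⟩ := exists_lipschitz_arc hE hu hv
  set A := ‖horizontal a‖ with hA
  set B := ‖horizontal b‖ with hB
  have hA0 : 0 ≤ A := norm_nonneg _
  have hB0 : 0 ≤ B := norm_nonneg _
  set p := a (Fin.last m) with hp
  set q := b (Fin.last m) with hq
  set τ := ‖u - v‖ with hτ
  have hτ0 : 0 ≤ τ := norm_nonneg _
  have hτ2 : τ ≤ 2 := (norm_sub_le _ _).trans (by rw [hu, hv]; norm_num)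
  have hAτ : A * τ ≤ 2 * d := h1.trans (by linarith)
  have hBτ : B * τ ≤ 2 * d := h2.trans (by linarith)
  have hAB : |B - A| ≤ d := by
    rw [abs_sub_comm]
    exact (abs_norm_sub_norm_le _ _).trans hdh
  have hpq : |q - p| ≤ d := by
    rw [abs_sub_comm, ← hdn]
    exact PiLp.norm_apply_le (a - b) (Fin.last m)
  -- Radius, direction and height are interpolated separately. The direction runs along an arc of
  -- the unit sphere of `ℝ^m`, connected because `m ≥ 2`; the extra `d t(1 - t)` in the radius opens
  -- the gap to the spike.
  set r : ℝ → ℝ := fun t => (1 - t) * A + t * B + d * (t * (1 - t)) with hr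
  set h : ℝ → ℝ := fun t => (1 - t) * p + t * q with hh
  set z : ℝ → Euc (m + 1) := fun t => snocEuc (r t • σ t) (h t) with hz
  have hz0 : z 0 = a := by
    simp only [hz, hr, hh, hσ0]
    have : ((1 - 0) * A + 0 * B + d * (0 * (1 - 0))) • u = horizontal a := by
      rw [hau]; congr 1; ring
    rw [this]
    have : (1 - 0) * p + 0 * q = p := by ring
    rw [this, hp, snocEuc_horizontal]
  have hz1 : z 1 = b := by
    simp only [hz, hr, hh, hσ1]
    have : ((1 - 1) * A + 1 * B + d * (1 * (1 - 1))) • v = horizontal b := by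
      rw [hbv]; congr 1; ring
    rw [this]
    have : (1 - 1) * p + 1 * q = q := by ring
    rw [this, hq, snocEuc_horizontal]
  have hquad : ∀ t ∈ Icc (0 : ℝ) 1, 0 ≤ t * (1 - t) ∧ t * (1 - t) ≤ 1 / 4 := fun t ht =>
    ⟨mul_nonneg ht.1 (sub_nonneg.2 ht.2), by nlinarith [sq_nonneg (t - 1 / 2)]⟩
  have hr0 : ∀ t ∈ Icc (0 : ℝ) 1, 0 ≤ r t := fun t ht =>
    add_nonneg (add_nonneg (mul_nonneg (sub_nonneg.2 ht.2) hA0) (mul_nonneg ht.1 hB0))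
      (mul_nonneg hd0 (hquad t ht).1)
  -- Near the axis the direction may turn far while `a` and `b` are close; only the turn multiplied
  -- by the radius matters, and that is controlled by `d`.
  have hrτ : ∀ t ∈ Icc (0 : ℝ) 1, r t * τ ≤ 3 * d := by
    intro t ht
    have e1 := mul_le_mul_of_nonneg_left hAτ (sub_nonneg.2 ht.2)
    have e2 := mul_le_mul_of_nonneg_left hBτ ht.1
    have e3 : d * (t * (1 - t)) * τ ≤ d * (1 / 4) * 2 := by
      gcongr
      exact (hquad t ht).2
    calc r t * τ = (1 - t) * (A * τ) + t * (B * τ) + d * (t * (1 - t)) * τ := by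
          simp only [hr]; ring
      _ ≤ (1 - t) * (2 * d) + t * (2 * d) + d * (1 / 4) * 2 := by linarith
      _ ≤ 3 * d := by linarith
  have hquadl : ∀ s ∈ Icc (0 : ℝ) 1, ∀ t ∈ Icc (0 : ℝ) 1,
      |s * (1 - s) - t * (1 - t)| ≤ |s - t| := by
    intro s hs t ht
    rw [show s * (1 - s) - t * (1 - t) = (1 - s - t) * (s - t) by ring, abs_mul]
    refine mul_le_of_le_one_left (abs_nonneg _) (abs_le.2 ⟨?_, ?_⟩) <;>
      linarith [hs.1, hs.2, ht.1, ht.2]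
  have hrl : ∀ s ∈ Icc (0 : ℝ) 1, ∀ t ∈ Icc (0 : ℝ) 1, |r s - r t| ≤ 2 * d * |s - t| := by
    intro s hs t ht
    calc |r s - r t| = |(s - t) * (B - A) + d * (s * (1 - s) - t * (1 - t))| := by
          congr 1; simp only [hr]; ring
      _ ≤ |s - t| * |B - A| + d * |s * (1 - s) - t * (1 - t)| := by
          refine (abs_add_le _ _).trans ?_
          rw [abs_mul, abs_mul, abs_of_nonneg hd0]
      _ ≤ |s - t| * d + d * |s - t| := by
          exact add_le_add (mul_le_mul_of_nonneg_left hAB (abs_nonneg _))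
            (mul_le_mul_of_nonneg_left (hquadl s hs t ht) hd0)
      _ = 2 * d * |s - t| := by ring
  have hzl : ∀ s ∈ Icc (0 : ℝ) 1, ∀ t ∈ Icc (0 : ℝ) 1, ‖z s - z t‖ ≤ 9 * d * |s - t| := by
    intro s hs t ht
    have e1 : ‖horizontal (z s - z t)‖ ≤ 8 * d * |s - t| := by
      rw [horizontal_sub]
      simp only [hz, horizontal_snocEuc]
      calc ‖r s • σ s - r t • σ t‖ = ‖(r s - r t) • σ s + r t • (σ s - σ t)‖ := by
            congr 1; module
        _ ≤ |r s - r t| * 1 + r t * (2 * τ * |s - t|) := by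
            refine (norm_add_le _ _).trans ?_
            rw [norm_smul, norm_smul, hσn, Real.norm_eq_abs, Real.norm_of_nonneg (hr0 t ht)]
            gcongr
            · exact hr0 t ht
            · exact hσl s t
        _ ≤ 2 * d * |s - t| + 2 * (3 * d) * |s - t| := by
            rw [mul_one, show r t * (2 * τ * |s - t|) = 2 * (r t * τ) * |s - t| by ring]
            exact add_le_add (hrl s hs t ht) (mul_le_mul_of_nonneg_right
              (mul_le_mul_of_nonneg_left (hrτ t ht) zero_le_two) (abs_nonneg _))
        _ = 8 * d * |s - t| := by ring
    have e2 : |(z s - z t) (Fin.last m)| ≤ d * |s - t| := by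
      simp only [hz, PiLp.sub_apply, snocEuc_last, hh]
      rw [show (1 - s) * p + s * q - ((1 - t) * p + t * q) = (q - p) * (s - t) by ring, abs_mul]
      gcongr
    linarith [norm_le_norm_horizontal_add (z s - z t)]
  refine ⟨z, hz0, hz1, hzl, fun t ht => ?_⟩
  have hP0 : 0 ≤ max p 0 := le_max_right _ _
  have hQ0 : 0 ≤ max q 0 := le_max_right _ _
  set P := max p 0
  set Q := max q 0
  have hpP : p ≤ P := le_max_left _ _
  have hqQ : q ≤ Q := le_max_left _ _
  have ht1 : 0 ≤ 1 - t := sub_nonneg.2 ht.2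
  have e0 : 0 ≤ (1 - t) * P + t * Q :=
    add_nonneg (mul_nonneg ht1 hP0) (mul_nonneg ht.1 hQ0)
  have e1 : max (h t) 0 ≤ (1 - t) * P + t * Q :=
    max_le (add_le_add (mul_le_mul_of_nonneg_left hpP ht1)
      (mul_le_mul_of_nonneg_left hqQ ht.1)) e0
  -- Convexity of the square: linear interpolation of radius and height does not enter the spike.
  have e2 : ((1 - t) * P + t * Q) ^ 2 ≤ (1 - t) * A + t * B := by
    have f1 := mul_le_mul_of_nonneg_left hP ht1
    have f2 := mul_le_mul_of_nonneg_left hQ ht.1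
    have f3 : 0 ≤ t * (1 - t) * (P - Q) ^ 2 := mul_nonneg (hquad t ht).1 (sq_nonneg _)
    nlinarith
  have e3 : max (h t) 0 ^ 2 ≤ (1 - t) * A + t * B :=
    (pow_le_pow_left₀ (le_max_right _ _) e1 2).trans e2
  have e4 : ‖horizontal (z t)‖ = r t := by
    simp only [hz, horizontal_snocEuc]
    rw [norm_smul, hσn, Real.norm_of_nonneg (hr0 t ht), mul_one]
  rw [e4]
  simp only [hz, snocEuc_last]
  exact add_le_add_left e3 _

/-- The curve around the spike may leave the cube, so it is contracted towards the origin by a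
factor `1 - l t` with `l` vanishing at both ends. Contraction preserves the spike inequality because
its left side is quadratic in the height and its right side linear in the radius. -/
theorem exists_lipschitz_curve_inwardCusp {m : ℕ} (hm : 2 ≤ m) {R : ℝ}
    (hR : ∀ x ∈ inwardCusp m (1 / 2), ‖x‖ ≤ R) {a b : Euc (m + 1)}
    (ha : a ∈ inwardCusp m (1 / 2)) (hb : b ∈ inwardCusp m (1 / 2)) (hd : dist a b < 1 / 11) :
    ∃ c : ℝ → Euc (m + 1), c 0 = a ∧ c 1 = b ∧
      (∀ s ∈ Icc (0 : ℝ) 1, ∀ t ∈ Icc (0 : ℝ) 1,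
        dist (c s) (c t) ≤ (21 * (R + 1) + 9) * dist a b * |s - t|) ∧
      ∀ t ∈ Ioo (0 : ℝ) 1, a ≠ b →
        Metric.ball (c t) (1 / 6 * (dist a b * (t * (1 - t)))) ⊆ inwardCusp m (1 / 2) := by
  obtain ⟨z, hz0, hz1, hzl, hrad⟩ := exists_lipschitz_curve_avoiding_spike hm
    (max_sq_le_of_mem_inwardCusp ha) (max_sq_le_of_mem_inwardCusp hb)
  set d := dist a b
  have hd0 : 0 ≤ d := dist_nonneg
  have hdn : ‖a - b‖ = d := (dist_eq_norm a b).symm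
  have hquad : ∀ t ∈ Icc (0 : ℝ) 1, 0 ≤ t * (1 - t) ∧ t * (1 - t) ≤ 1 / 4 := fun t ht =>
    ⟨mul_nonneg ht.1 (sub_nonneg.2 ht.2), by nlinarith [sq_nonneg (t - 1 / 2)]⟩
  have hquadl : ∀ s ∈ Icc (0 : ℝ) 1, ∀ t ∈ Icc (0 : ℝ) 1,
      |s * (1 - s) - t * (1 - t)| ≤ |s - t| := by
    intro s hs t ht
    rw [show s * (1 - s) - t * (1 - t) = (1 - s - t) * (s - t) by ring, abs_mul]
    refine mul_le_of_le_one_left (abs_nonneg _) (abs_le.2 ⟨?_, ?_⟩) <;>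
      linarith [hs.1, hs.2, ht.1, ht.2]
  -- The segment from `a` to `b` stays in the convex cube, and the curve deviates from it by at most
  -- `10 d` times either `t` or `1 - t`. Averaging the two bounds with weights `1 - t` and `t` gives
  -- `20 d t(1 - t)`.
  have hzcube : ∀ t ∈ Icc (0 : ℝ) 1, ∀ i, |z t i| ≤ 1 + 20 * (d * (t * (1 - t))) := by
    intro t ht i
    have ht' : 0 ≤ 1 - t := sub_nonneg.2 ht.2
    have e1 : ‖z t - ((1 - t) • a + t • b)‖ ≤ 10 * d * t := by
      have f1 := hzl t ht 0 (by simp)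
      rw [hz0, sub_zero, abs_of_nonneg ht.1] at f1
      have f2 : ‖t • (a - b)‖ = d * t := by
        rw [norm_smul, hdn, Real.norm_of_nonneg ht.1, mul_comm]
      calc _ = ‖(z t - a) + t • (a - b)‖ := by congr 1; module
        _ ≤ 9 * d * t + d * t := (norm_add_le _ _).trans (add_le_add f1 f2.le)
        _ = 10 * d * t := by ring
    have e2 : ‖z t - ((1 - t) • a + t • b)‖ ≤ 10 * d * (1 - t) := by
      have f1 := hzl t ht 1 (by simp)
      rw [hz1, abs_sub_comm, abs_of_nonneg ht'] at f1
      have f2 : ‖(1 - t) • (a - b)‖ = d * (1 - t) := by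
        rw [norm_smul, hdn, Real.norm_of_nonneg ht', mul_comm]
      calc _ = ‖(z t - b) - (1 - t) • (a - b)‖ := by congr 1; module
        _ ≤ 9 * d * (1 - t) + d * (1 - t) := (norm_sub_le _ _).trans (add_le_add f1 f2.le)
        _ = 10 * d * (1 - t) := by ring
    have e3 : ‖z t - ((1 - t) • a + t • b)‖ ≤ 20 * (d * (t * (1 - t))) := by
      nlinarith [mul_le_mul_of_nonneg_right e1 ht', mul_le_mul_of_nonneg_right e2 ht.1]
    have e4 : |z t i - ((1 - t) * a i + t * b i)| ≤ ‖z t - ((1 - t) • a + t • b)‖ :=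
      PiLp.norm_apply_le (z t - ((1 - t) • a + t • b)) i
    have e5 : |(1 - t) * a i + t * b i| ≤ 1 := by
      have g1 : |a i| ≤ 1 := (abs_lt.2 (ha.1 i)).le
      have g2 : |b i| ≤ 1 := (abs_lt.2 (hb.1 i)).le
      refine (abs_add_le _ _).trans ?_
      rw [abs_mul, abs_mul, abs_of_nonneg ht', abs_of_nonneg ht.1]
      nlinarith [mul_le_mul_of_nonneg_left g1 ht', mul_le_mul_of_nonneg_left g2 ht.1]
    have e6 : |z t i| ≤ |(1 - t) * a i + t * b i| + |z t i - ((1 - t) * a i + t * b i)| := by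
      simpa using abs_add_le ((1 - t) * a i + t * b i) (z t i - ((1 - t) * a i + t * b i))
    linarith
  have hzn : ∀ t ∈ Icc (0 : ℝ) 1, ‖z t‖ ≤ R + 1 := by
    intro t ht
    have f1 := hzl t ht 0 (by simp)
    rw [hz0, sub_zero, abs_of_nonneg ht.1] at f1
    have f2 : 9 * d * t ≤ 9 * d * 1 := by gcongr; exact ht.2
    have f3 : ‖z t‖ ≤ ‖a‖ + ‖z t - a‖ := by
      simpa using norm_add_le a (z t - a)
    linarith [hR a ha]
  -- With `y = d t(1 - t)`, the constant `21` beats the overshoot: `(1 - 21y)(1 + 20y) ≤ 1 - y`. The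
  -- bound `d < 1/11` keeps `l` below `1/2`, so at least half of the gap to the spike survives.
  set l : ℝ → ℝ := fun t => 21 * (d * (t * (1 - t))) with hl
  have hl0 : ∀ t ∈ Icc (0 : ℝ) 1, 0 ≤ l t ∧ l t ≤ 1 / 2 := fun t ht =>
    ⟨mul_nonneg (by norm_num) (mul_nonneg hd0 (hquad t ht).1), by
      have := mul_le_mul_of_nonneg_left (hquad t ht).2 hd0
      simp only [hl]
      linarith⟩
  refine ⟨fun t => (1 - l t) • z t, ?_, ?_, fun s hs t ht => ?_, fun t ht hab => ?_⟩
  · simp [hl, hz0]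
  · simp [hl, hz1]
  · rw [dist_eq_norm]
    calc ‖(1 - l s) • z s - (1 - l t) • z t‖ = ‖(1 - l t) • (z s - z t) - (l s - l t) • z s‖ := by
          congr 1; module
      _ ≤ 1 * (9 * d * |s - t|) + 21 * d * |s - t| * (R + 1) := by
          refine (norm_sub_le _ _).trans ?_
          rw [norm_smul, norm_smul]
          gcongr
          · rw [Real.norm_eq_abs, abs_le]
            constructor <;> linarith [(hl0 t ht).1, (hl0 t ht).2]
          · exact hzl s hs t ht
          · rw [Real.norm_eq_abs, show l s - l t = 21 * d * (s * (1 - s) - t * (1 - t)) by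
              simp only [hl]; ring, abs_mul, abs_of_nonneg (by positivity)]
            exact mul_le_mul_of_nonneg_left (hquadl s hs t ht) (by positivity)
          · exact hzn s hs
      _ = _ := by ring
  · have hdpos : 0 < d := dist_pos.2 hab
    have ht' : t ∈ Icc (0 : ℝ) 1 := Ioo_subset_Icc_self ht
    have hg := hrad t ht'
    set y := d * (t * (1 - t)) with hy
    have hy0 : 0 < y := mul_pos hdpos (mul_pos ht.1 (sub_pos.2 ht.2))
    have hlt : l t = 21 * y := rfl
    obtain ⟨hl1, hl2⟩ := hl0 t ht'
    rw [hlt] at hl1 hl2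
    change Metric.ball ((1 - 21 * y) • z t) _ ⊆ _
    rw [show 1 / 6 * y = y / 2 / 3 by ring]
    refine ball_subset_inwardCusp (by linarith) (fun i => ?_) ?_
    · rw [PiLp.smul_apply, smul_eq_mul, abs_mul, abs_of_nonneg (by linarith)]
      have := mul_le_mul_of_nonneg_left (hzcube t ht' i) (show 0 ≤ 1 - 21 * y by linarith)
      nlinarith
    · have hmax : max (((1 - 21 * y) • z t) (Fin.last m)) 0
          = (1 - 21 * y) * max (z t (Fin.last m)) 0 := by
        rw [PiLp.smul_apply, smul_eq_mul, mul_max_of_nonneg _ _ (by linarith), mul_zero]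
      rw [hmax, horizontal_smul, norm_smul, Real.norm_of_nonneg (by linarith)]
      have e5 : 0 ≤ max (z t (Fin.last m)) 0 ^ 2 := sq_nonneg _
      set k := 1 - 21 * y with hk
      have hk0 : 1 / 2 ≤ k := by linarith
      have hk1 : k ≤ 1 := by linarith
      have e6 : (k * max (z t (Fin.last m)) 0) ^ 2 ≤ k * max (z t (Fin.last m)) 0 ^ 2 := by
        rw [mul_pow]
        exact mul_le_mul_of_nonneg_right (by nlinarith) e5
      have e7 := mul_le_mul_of_nonneg_left hg (show 0 ≤ k by linarith)
      have e8 := mul_le_mul_of_nonneg_right hk0 hy0.le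
      linarith

/-- In dimension at least three, the complement of a quadratic spike is an `(ε, δ)`-domain. -/
theorem isEpsDeltaDomain_inwardCusp {m : ℕ} (hm : 2 ≤ m) :
    ∃ (ε : ℝ) (δ : ℝ≥0∞), IsEpsDeltaDomain ε δ (inwardCusp m (1 / 2)) := by
  obtain ⟨R, hR0, hR⟩ := ((isBounded_forall_mem_Ioo (m + 1)).subset
    fun x (hx : x ∈ inwardCusp m (1 / 2)) => hx.1).exists_pos_norm_le
  refine ⟨_, _, isEpsDeltaDomain_of_lipschitz_curves (isOpen_inwardCusp (by norm_num) m)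
    (L := 21 * (R + 1) + 9) (κ := 1 / 6) (δ := 1 / 11) (by linarith) (by norm_num) (by norm_num)
    (by norm_num) fun x hx y hy hxy hd => ?_⟩
  obtain ⟨c, h0, h1, hl, hb⟩ := exists_lipschitz_curve_inwardCusp hm hR hx hy hd
  exact ⟨c, h0, h1, hl, fun t ht => hb t ht hxy⟩

/-! ### The inward cusp domain is homeomorphic to a ball -/

/-- An open bounded interval is homeomorphic to the line. -/
noncomputable def homeomorphIooReal : Ioo (-1 : ℝ) 1 ≃ₜ ℝ :=
  (Homeomorph.setCongr (by rw [Real.ball_eq_Ioo]; norm_num)).trans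
    (Homeomorph.unitBall (E := ℝ)).symm

/-- The truncated profile whose strict subgraph over a cube is the inward cusp. -/
noncomputable def cuspHeight {m : ℕ} (γ : ℝ) (x : Euc m) : ℝ := min 1 (cuspProfile γ ‖x‖)

theorem continuous_cuspHeight {m : ℕ} {γ : ℝ} (hγ : 0 < γ) :
    Continuous (cuspHeight (m := m) γ) :=
  continuous_const.min ((continuous_cuspProfile hγ).comp continuous_norm)

/-- Guarantees that the vertical fibres, which start at `-1`, have length at least `1`, so rescaling
them is continuous. -/
theorem cuspHeight_nonneg {m : ℕ} {γ : ℝ} (hγ : 0 < γ) (x : Euc m) : 0 ≤ cuspHeight γ x := by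
  rw [cuspHeight, cuspProfile_of_nonneg hγ (norm_nonneg _)]
  positivity

/-- Truncating the profile at `1` absorbs the cube's constraint `y < 1`, so every fibre over the
open cube is a single interval. -/
theorem mem_inwardCusp_iff {m : ℕ} {γ : ℝ} {x : Euc (m + 1)} :
    x ∈ inwardCusp m γ ↔ (∀ i, horizontal x i ∈ Ioo (-1 : ℝ) 1) ∧
      -1 < x (Fin.last m) ∧ x (Fin.last m) < cuspHeight γ (horizontal x) := by
  rw [cuspHeight, lt_min_iff]
  change ((∀ i, x i ∈ Ioo (-1 : ℝ) 1) ∧ _) ↔ _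
  rw [Fin.forall_fin_succ']
  simp only [horizontal_apply, mem_Ioo]
  tauto

theorem continuous_snocEuc {m : ℕ} : Continuous fun z : Euc m × ℝ => snocEuc z.1 z.2 :=
  (PiLp.continuous_toLp 2 _).comp
    (Continuous.finSnoc (by fun_prop) continuous_snd)

/-- The subgraph is homeomorphic to a product of open intervals, by vertical rescaling. -/
noncomputable def inwardCuspHomeomorph (m : ℕ) {γ : ℝ} (hγ : 0 < γ) :
    inwardCusp m γ ≃ₜ (Fin m → Ioo (-1 : ℝ) 1) × Ioo (-1 : ℝ) 1 where
  toFun x := (fun i => ⟨horizontal x.1 i, (mem_inwardCusp_iff.1 x.2).1 i⟩,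
    ⟨2 * (x.1 (Fin.last m) + 1) / (cuspHeight γ (horizontal x.1) + 1) - 1, by
      obtain ⟨-, h1, h2⟩ := mem_inwardCusp_iff.1 x.2
      have h3 := cuspHeight_nonneg hγ (horizontal x.1)
      constructor
      · have : 0 < 2 * (x.1 (Fin.last m) + 1) / (cuspHeight γ (horizontal x.1) + 1) :=
          div_pos (by linarith) (by linarith)
        linarith
      · have : 2 * (x.1 (Fin.last m) + 1) / (cuspHeight γ (horizontal x.1) + 1) < 2 := by
          rw [div_lt_iff₀ (by linarith)]
          linarith
        linarith⟩)
  invFun z := ⟨snocEuc (WithLp.toLp 2 fun i => (z.1 i : ℝ))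
      (((z.2 : ℝ) + 1) / 2 * (cuspHeight γ (WithLp.toLp 2 fun i => (z.1 i : ℝ)) + 1) - 1), by
    rw [mem_inwardCusp_iff, horizontal_snocEuc, snocEuc_last]
    have h3 := cuspHeight_nonneg hγ (WithLp.toLp 2 fun i => (z.1 i : ℝ))
    have h1 : 0 < ((z.2 : ℝ) + 1) / 2 := by linarith [z.2.2.1]
    have h2 : ((z.2 : ℝ) + 1) / 2 < 1 := by linarith [z.2.2.2]
    refine ⟨fun i => (z.1 i).2, ?_, ?_⟩ <;> nlinarith⟩
  left_inv x := by
    have h3 := cuspHeight_nonneg hγ (horizontal x.1)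
    refine Subtype.ext ?_
    simp only
    have h4 : (WithLp.toLp 2 fun i => horizontal x.1 i : Euc m) = horizontal x.1 := rfl
    rw [h4]
    conv_rhs => rw [← snocEuc_horizontal x.1]
    congr 1
    have : cuspHeight γ (horizontal x.1) + 1 ≠ 0 := by positivity
    field_simp
    ring
  right_inv z := by
    have h3 := cuspHeight_nonneg hγ (WithLp.toLp 2 fun i => (z.1 i : ℝ))
    refine Prod.ext ?_ ?_
    · ext i
      simp
    · refine Subtype.ext ?_
      simp only [horizontal_snocEuc, snocEuc_last]
      have : cuspHeight γ (WithLp.toLp 2 fun i => (z.1 i : ℝ)) + 1 ≠ 0 := by positivity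
      field_simp
      ring
  continuous_toFun := by
    have h1 : Continuous fun x : inwardCusp m γ => horizontal x.1 :=
      (continuous_horizontal m).comp continuous_subtype_val
    have h2 : Continuous fun x : inwardCusp m γ => x.1 (Fin.last m) := by fun_prop
    refine Continuous.prodMk (continuous_pi fun i => Continuous.subtype_mk ?_ _)
      (Continuous.subtype_mk ?_ _)
    · exact (EuclideanSpace.proj i).continuous.comp h1
    · refine ((continuous_const.mul (h2.add continuous_const)).div
        (((continuous_cuspHeight hγ).comp h1).add continuous_const) fun x => ?_).sub
        continuous_const
      exact (add_pos_of_nonneg_of_pos (cuspHeight_nonneg hγ (horizontal x.1)) one_pos).ne'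
  continuous_invFun := by
    have h1 : Continuous fun z : (Fin m → Ioo (-1 : ℝ) 1) × Ioo (-1 : ℝ) 1 =>
        (WithLp.toLp 2 fun i => (z.1 i : ℝ) : Euc m) := by fun_prop
    refine Continuous.subtype_mk (continuous_snocEuc.comp (h1.prodMk ?_)) _
    have := (continuous_cuspHeight hγ).comp h1
    simp only [Function.comp_def] at this
    fun_prop

theorem nonempty_inwardCusp_homeomorph_ball (m : ℕ) {γ : ℝ} (hγ : 0 < γ) :
    Nonempty (inwardCusp m γ ≃ₜ Metric.ball (0 : Euc (m + 1)) 1) := by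
  have e : ((Fin m → ℝ) × ℝ) ≃L[ℝ] Euc (m + 1) :=
    ContinuousLinearEquiv.ofFinrankEq (by simp)
  exact ⟨(inwardCuspHomeomorph m hγ).trans
    (((Homeomorph.piCongrRight fun _ => homeomorphIooReal).prodCongr homeomorphIooReal).trans
      (e.toHomeomorph.trans Homeomorph.unitBall))⟩

theorem theorem8p3 :
    -- (a) outward cusps in the plane
    (∀ γ : ℝ, 0 < γ → γ < 1 →
      ∃ (p : ℝ≥0∞) (_ : Fact (1 ≤ p)), p < ⊤ ∧
        ∀ η : ℝ, 0 < η →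
          ¬ HasSolenoidalExtension p (outwardCusp 1 γ)
              (Metric.thickening η (outwardCusp 1 γ))) ∧
    -- (b) inward cusps in dimension n = m + 1 ≥ 2
    (∀ m : ℕ, 2 ≤ m + 1 → ∀ γ : ℝ, 0 < γ → γ < 1 →
      ∃ (p : ℝ≥0∞) (_ : Fact (1 ≤ p)), 1 < p ∧ p < ⊤ ∧
        ∀ η : ℝ, 0 < η →
          ¬ HasSolenoidalExtension p (inwardCusp m γ)
              (Metric.thickening η (inwardCusp m γ))) ∧
    -- (c) (ε, δ)-domains in dimension n ≥ 3
    (∀ n : ℕ, 3 ≤ n →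
      ∃ (Ω : Set (Euc n)) (p : ℝ≥0∞) (_ : Fact (1 ≤ p)),
        (∃ (ε : ℝ) (δ : ℝ≥0∞), IsEpsDeltaDomain ε δ Ω) ∧
        Bornology.IsBounded Ω ∧ Nonempty (Ω ≃ₜ Metric.ball (0 : Euc n) 1) ∧
        1 < p ∧ p < ⊤ ∧
        ∀ η : ℝ, 0 < η →
          ¬ HasSolenoidalExtension p Ω (Metric.thickening η Ω)) := by
  refine ⟨fun γ hγ hγ1 => outwardCusp_not_hasSolenoidalExtension hγ hγ1,
    fun m hm γ hγ hγ1 => inwardCusp_not_hasSolenoidalExtension (by omega) hγ hγ1,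
    fun n hn => ?_⟩
  obtain ⟨m, rfl⟩ : ∃ m, n = m + 1 := ⟨n - 1, by omega⟩
  -- The exponent `1/2` is the case in which the spike is `|x'| ≤ y²`, for which the curves were
  -- constructed.
  obtain ⟨p, hp, hp1, hpt, h⟩ := inwardCusp_not_hasSolenoidalExtension (m := m) (by omega)
    (γ := 1 / 2) (by norm_num) (by norm_num)
  exact ⟨inwardCusp m (1 / 2), p, hp, isEpsDeltaDomain_inwardCusp (by omega),
    (isBounded_forall_mem_Ioo (m + 1)).subset fun x hx => hx.1,
    nonempty_inwardCusp_homeomorph_ball m (by norm_num), hp1, hpt, h⟩
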